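/- **Theorem 2.6 (Branching formula for the $B_N$ $q$-Toda function).** Let $N\ge 1$, let $K$ be a field of characteristic $0$, let $q\in K$ be non-zero and not a root of unity, and let $s_1,\dots,s_N\in K$ be algebraically independent over $\mathbb{Q}(q)$ (for example $K=\mathbb{Q}(s,q)$ with indeterminates $q,s_1,\dots,s_N$). Put $(a;q)_n:=\prod_{k=1}^n(1-q^{k-1}a)$ and $\Lambda^{B_N}:=K[[x_2/x_1,\dots,x_N/x_{N-1},1/x_N]]$, and let $T_{q,x_i}$ be the operator substituting $qx_i$ for $x_i$. For non-zero $s=(s_1,\dots,s_N)$ define $$f^{A_{N-1}\mathrm{Toda}}(x|s|q)=\sum_{\boldsymbol\theta}c_N^{\mathrm{Toda}}(\boldsymbol\theta;s;q)\prod_{1\le i<j\le N}(x_j/x_i)^{\theta_{i,j}},$$ where $\boldsymbol\theta=(\theta_{i,j})$ runs over the strictly upper triangular $N\times N$ matrices with entries in $\mathbb{Z}_{\ge0}$ and $$c_N^{\mathrm{Toda}}(\boldsymbol\theta;s;q)=\prod_{k=2}^{N}\ \prod_{1\le i\le j\le k-1}\frac{1}{\bigl(q^{\sum_{a=k+1}^N(\theta_{i,a}-\theta_{j+1,a})}qs_{j+1}/s_i;q\bigr)_{\theta_{i,k}}}\cdot\frac{q^{\theta_{i,k}}}{\bigl(q^{\theta_{j,k}-\theta_{i,k}-\sum_{a=k+1}^N(\theta_{i,a}-\theta_{j,a})}qs_i/s_j;q\bigr)_{\theta_{i,k}}}.$$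 Let $$\mathsf D^{B_N}=\sum_{i=1}^{N-1}s_i(1-x_{i+1}/x_i)T_{q,x_i}+s_N(1-1/x_N)T_{q,x_N}+s_1^{-1}T_{q,x_1}^{-1}+\sum_{i=2}^Ns_i^{-1}(1-x_i/x_{i-1})T_{q,x_i}^{-1}.$$ Then there is exactly one $f^{B_N\mathrm{Toda}}(x|s|q)\in\Lambda^{B_N}$ with constant term $1$ and $$\mathsf D^{B_N}f^{B_N\mathrm{Toda}}(x|s|q)=\sum_{i=1}^N(s_i+s_i^{-1})\,f^{B_N\mathrm{Toda}}(x|s|q),$$ and it is given by $$f^{B_N\mathrm{Toda}}(x|s|q)=\sum_{\theta\in\mathbb{Z}_{\ge0}^N}e^{B_N/A_{N-1}}_\theta(s|q)\prod_{i=1}^Nx_i^{-\theta_i}\cdot f^{A_{N-1}\mathrm{Toda}}(x|q^{-\theta_1}s_1,\dots,q^{-\theta_N}s_N|q),$$ where $$e^{B_N/A_{N-1}}_\theta(s|q)=\prod_{k=1}^N\frac{q^{(N-k+1)\theta_k}}{(q;q)_{\theta_k}(q/s_k^2;q)_{\theta_k}}\ \prod_{1\le i<j\le N}\frac{1}{(qs_j/s_i;q)_{\theta_i}(q^{\theta_j-\theta_i}qs_i/s_j;q)_{\theta_i}}\cdot\frac{(q/s_is_j;q)_{\theta_i+\theta_j}}{(q/s_is_j;q)_{\theta_i}(q/s_is_j;q)_{\theta_j}}.$$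 The sum is a sum of formal power series: for each monomial only finitely many $\theta$ contribute to its coefficient, and the coefficients agree. -/

import Mathlib

namespace QToda

noncomputable section

/-- The `q`-Pochhammer symbol `(a; q)_n = ∏_{k=1}^n (1 - q^{k-1} a)`. -/
def qPoch {K : Type*} [Field K] (a q : K) (n : ℕ) : K :=
  ∏ k ∈ Finset.range n, (1 - q ^ k * a)

/-- The ring `K[[x_2/x_1, …, x_N/x_{N-1}, 1/x_N]]` of formal power series in the `N` variables
`y_1 = x_2/x_1, …, y_{N-1} = x_N/x_{N-1}, y_N = 1/x_N` (indices are shifted to start from `0`).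
The ring `K[[x_2/x_1, …, x_N/x_{N-1}]]` is the subring of the series not involving the last
variable. -/
abbrev LambdaB (N : ℕ) (K : Type*) : Type _ := MvPowerSeries (Fin N) K

variable {N : ℕ} {K : Type*} [Field K]

/-- `f` is the sum of the (possibly infinite) family `g` of formal power series: for each monomial,
only finitely many members of the family contribute to its coefficient, and the contributions
add up to the coefficient in `f`. -/
def HasFormalSum {ι σ : Type*} (g : ι → MvPowerSeries σ K) (f : MvPowerSeries σ K) : Prop :=
  ∀ m : σ →₀ ℕ, {i | MvPowerSeries.coeff m (g i) ≠ 0}.Finite ∧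
    ∑ᶠ i, MvPowerSeries.coeff m (g i) = MvPowerSeries.coeff m f

/-- The coefficientwise sum of a family of formal power series in which each monomial occurs
only finitely often. -/
def formalSum {ι σ : Type*} (g : ι → MvPowerSeries σ K) : MvPowerSeries σ K :=
  fun m => ∑ᶠ i, MvPowerSeries.coeff m (g i)

/-- For `0 ≤ i ≤ j ≤ N` (indices starting from `0`), the monomial `x_j/x_i = y_i y_{i+1} ⋯ y_{j-1}`,
where `x_N` stands for `1`. In particular `xRatio i N` is `1/x_i`. -/
def xRatio (N : ℕ) (K : Type*) [Field K] (i j : ℕ) : LambdaB N K :=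
  ∏ k ∈ Finset.univ.filter (fun k : Fin N => i ≤ (k : ℕ) ∧ (k : ℕ) < j), MvPowerSeries.X k

/-- The exponent of `x_i` in the monomial `∏_k y_k^{m_k}`, namely `m_{i-1} - m_i`
(just `- m_i` for the first index). -/
def xExponent (m : Fin N →₀ ℕ) (i : Fin N) : ℤ :=
  (∑ k ∈ Finset.univ.filter (fun k : Fin N => (k : ℕ) + 1 = (i : ℕ)), (m k : ℤ)) - (m i : ℤ)

/-- The difference operator `T_{q,x_i}`, substituting `q x_i` for `x_i`. Its inverse is
`T_{q⁻¹,x_i}`. -/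
def qShift (q : K) (i : Fin N) (f : LambdaB N K) : LambdaB N K :=
  fun m => q ^ xExponent m i * MvPowerSeries.coeff m f

/-- The `B_N` `q`-Toda operator
`∑_{i<N} s_i (1 - x_{i+1}/x_i) T_{q,x_i} + s_N (1 - 1/x_N) T_{q,x_N}
  + s_1⁻¹ T_{q,x_1}⁻¹ + ∑_{i≥2} s_i⁻¹ (1 - x_i/x_{i-1}) T_{q,x_i}⁻¹`. -/
def todaOpB (q : K) (s : Fin N → K) (f : LambdaB N K) : LambdaB N K :=
  (∑ i : Fin N, s i • ((1 - xRatio N K (i : ℕ) ((i : ℕ) + 1)) * qShift q i f)) +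
  ∑ i : Fin N, (s i)⁻¹ •
    ((1 - if (i : ℕ) = 0 then 0 else xRatio N K ((i : ℕ) - 1) (i : ℕ)) * qShift q⁻¹ i f)

/-- The defining property of the asymptotically free eigenfunction of the `B_N` `q`-Toda operator:
eigenfunction with eigenvalue `∑ (s_i + s_i⁻¹)` and constant term `1`. -/
def IsTodaFunctionB (q : K) (s : Fin N → K) (f : LambdaB N K) : Prop :=
  todaOpB q s f = (∑ i, (s i + (s i)⁻¹)) • f ∧ MvPowerSeries.constantCoeff f = 1

/-- Strictly upper triangular `N × N` matrices with non-negative integer entries. -/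
def UpperMatrix (N : ℕ) : Type :=
  {θ : Fin N → Fin N → ℕ // ∀ k l, l ≤ k → θ k l = 0}

/-- The coefficients `c_N^{Toda}(θ; s; q)`. In the first product the index `l` is `j + 1`
with `i ≤ j ≤ k - 1`, that is, `i < l ≤ k`. -/
def cToda (θ : Fin N → Fin N → ℕ) (s : Fin N → K) (q : K) : K :=
  ∏ k : Fin N,
    ((∏ i : Fin N, ∏ l : Fin N with i < l ∧ l ≤ k,
        1 / qPoch (q ^ (∑ a : Fin N with k < a, ((θ i a : ℤ) - θ l a)) * q * s l / s i) q (θ i k)) *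
     ∏ i : Fin N, ∏ j : Fin N with i ≤ j ∧ j < k,
        q ^ θ i k /
          qPoch (q ^ ((θ j k : ℤ) - θ i k - ∑ a : Fin N with k < a, ((θ i a : ℤ) - θ j a)) *
            q * s i / s j) q (θ i k))

/-- The summand `c_N^{Toda}(θ; s; q) ∏_{i<j} (x_j/x_i)^{θ_{ij}}` of the `A_{N-1}` Toda function. -/
def todaTermA (q : K) (s : Fin N → K) (θ : UpperMatrix N) : LambdaB N K :=
  cToda θ.1 s q • ∏ i : Fin N, ∏ j : Fin N with i < j, xRatio N K i j ^ θ.1 i j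

/-- The `A_{N-1}` `q`-Toda function
`f(x|s|q) = ∑_θ c_N^{Toda}(θ; s; q) ∏_{i<j} (x_j/x_i)^{θ_{ij}}`. -/
def todaFunctionA (q : K) (s : Fin N → K) : LambdaB N K :=
  formalSum (todaTermA q s)

/-- The branching coefficient `e_θ^{B_N/A_{N-1}}(s|q)`; as the index `k` starts from `0`,
the exponent `N - k + 1` becomes `N - k`. -/
def eCoeff (q : K) (s : Fin N → K) (θ : Fin N → ℕ) : K :=
  (∏ k : Fin N, q ^ ((N - (k : ℕ)) * θ k) /
      (qPoch q q (θ k) * qPoch (q / s k ^ 2) q (θ k))) *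
  ∏ i : Fin N, ∏ j : Fin N with i < j,
    (1 / (qPoch (q * s j / s i) q (θ i) *
        qPoch (q ^ ((θ j : ℤ) - θ i) * q * s i / s j) q (θ i))) *
    (qPoch (q / (s i * s j)) q (θ i + θ j) /
      (qPoch (q / (s i * s j)) q (θ i) * qPoch (q / (s i * s j)) q (θ j)))

/-- The summand
`e_θ(s|q) ∏ x_i^{-θ_i} f^{A_{N-1} Toda}(x | q^{-θ_1} s_1, …, q^{-θ_N} s_N | q)`. -/
def branchingTerm (q : K) (s : Fin N → K) (θ : Fin N → ℕ) : LambdaB N K :=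
  eCoeff q s θ • ((∏ i : Fin N, xRatio N K i N ^ θ i) *
    todaFunctionA q (fun i => q ^ (-(θ i : ℤ)) * s i))

/-- The family defining the `A_{N-1}` Toda function is locally finite, so that the sum makes
sense. -/
theorem hasFormalSum_todaFunctionA (q : K) (s : Fin N → K) :
    HasFormalSum (todaTermA q s) (todaFunctionA q s) := by
  intro m
  refine ⟨?_, rfl⟩
  have key : ∀ θ : UpperMatrix N, MvPowerSeries.coeff m (todaTermA q s θ) ≠ 0 →
      ∀ i j, θ.1 i j ≤ m i := by
    intro θ h i j
    by_cases hij : i < j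
    swap
    · rw [θ.2 i j (not_lt.mp hij)]; exact Nat.zero_le _
    by_contra hlt
    apply h
    have hdvd : (MvPowerSeries.X i : LambdaB N K) ^ θ.1 i j ∣ todaTermA q s θ := by
      have h1 : (MvPowerSeries.X i : LambdaB N K) ∣ xRatio N K i j :=
        Finset.dvd_prod_of_mem _ (Finset.mem_filter.mpr ⟨Finset.mem_univ i, le_refl _, hij⟩)
      have h2 := (pow_dvd_pow_of_dvd h1 (θ.1 i j)).trans
        (Finset.dvd_prod_of_mem (fun j : Fin N => xRatio N K i j ^ θ.1 i j)
          (show j ∈ Finset.univ.filter (fun j => i < j) by simpa using hij))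
      have h3 := h2.trans (Finset.dvd_prod_of_mem
        (fun i : Fin N => ∏ j : Fin N with i < j, xRatio N K i j ^ θ.1 i j) (Finset.mem_univ i))
      unfold todaTermA
      rw [MvPowerSeries.smul_eq_C_mul]
      exact h3.mul_left _
    exact (MvPowerSeries.X_pow_dvd_iff.mp hdvd) m (not_le.mp hlt)
  have hfin : {g : Fin N → Fin N → ℕ | ∀ i j, g i j ≤ m i}.Finite := by
    have : {g : Fin N → Fin N → ℕ | ∀ i j, g i j ≤ m i} = Set.Iic (fun i _ => m i) := by
      ext g; simp [Pi.le_def]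
    rw [this]
    exact Set.finite_Iic _
  exact Set.Finite.subset (hfin.preimage (Subtype.val_injective.injOn)) fun θ hθ => key θ hθ

end

end QToda

/-! ### Pair factors of the coefficients under unit steps -/

namespace QToda

noncomputable section

variable {K : Type*} [Field K]

/-! Index the variables from 0, put `x_N = 1`, and let `f_n(s)` be the A-type function in the first
`n` variables. Everything is expanded in the families `g_θ = ∏ (x_n/x_i)^{θ_i} f_n(q^{-θ} s)`
(`todaBasis`). The Toda operators act on such a family by a diagonal part plus steps `θ → θ + e_i`,
so an eigenvalue equation for `∑ c_θ g_θ` reduces to a scalar recursion for `c_θ`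
(`eigen_of_recursion`).

Splitting off the last column of the matrix `θ` gives the A-type branching `f_{n+1}(s) = ∑ b_θ g_θ`
(`cToda_snoc`, `hasSum_branchCoeffA`). Comparing such expansions yields two Pieri formulas, which
write `(x_{n+1}/x_n) f_{n+1}(s)` and `s_n (x_{n+1}/x_n) T_{q,x_n} f_{n+1}(s)` as combinations of
`(x_{n+1}/x_i) f_{n+1}(q^{-e_i} s)`. These formulas compute the raising parts. By induction on `n`,
`f_n` is then an eigenfunction of the A-type operators with direct and with inverse shifts, with
eigenvalues `∑ s_i` and `∑ s_i⁻¹`.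

The B-type operator is the sum of these two minus the boundary term `s_N (1/x_N) T_{q,x_N}`. On
`g_θ` with `t = q^{-θ} s` its diagonal part is `∑ (t_i + t_i⁻¹)`, and the second Pieri formula gives
the raising part (`boundaryOp_todaBasis`).

Each recursion is a Lagrange interpolation identity: the raising coefficient times `c_{θ-e_i}/c_θ`
is an interpolation weight. The nodes are the `t_i` or their inverses in type A, and `t_i + t_i⁻¹`
in type B, where the roots are `s_i + s_i⁻¹` (`eCoeff_eigen`).

Uniqueness holds because the operator is triangular for the degree, and its diagonal entry at a
non-constant monomial differs from the eigenvalue by algebraic independence. -/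

theorem qPoch_succ (a q : K) (n : ℕ) : qPoch a q (n + 1) = qPoch a q n * (1 - q ^ n * a) := by
  simp [qPoch, Finset.prod_range_succ]

theorem qPoch_succ' (a q : K) (n : ℕ) : qPoch a q (n + 1) = (1 - a) * qPoch (q * a) q n := by
  simp only [qPoch, Finset.prod_range_succ', pow_zero, one_mul, pow_succ, mul_assoc]
  rw [mul_comm]

theorem qPoch_mul_one_sub (a q : K) (n : ℕ) :
    qPoch a q n * (1 - q ^ n * a) = (1 - a) * qPoch (q * a) q n := by
  rw [← qPoch_succ, qPoch_succ']

/-- The factor of a branching coefficient attached to a pair of indices. -/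
def pairCoeff (q a b : K) (m k : ℕ) : K :=
  q ^ m / (qPoch (q * b / a) q m * qPoch (q ^ ((k : ℤ) - m) * q * a / b) q m)

/-- With `a = s_i`, `b = s_j` and `t` the parameters after the step, the right-hand factor is the
Lagrange factor `(t_i - s_j)/(t_i - t_j)`. The left-hand one is the factor of `pieriCoeff` for `j >
i`. -/
theorem pairCoeff_left_step {q a b : K} (hq : q ≠ 0) (ha : a ≠ 0) (hb : b ≠ 0)
    (h : ∀ m k : ℕ, q ^ m * a ≠ q ^ k * b) (m k : ℕ) :
    pairCoeff q a b m k *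
      (q / ((1 - q * (q ^ (-(k : ℤ)) * b) / (q ^ (-(m : ℤ)) * a)) *
        (1 - (q ^ (-(m : ℤ)) * a) / (q ^ (-(k : ℤ)) * b)))) =
    pairCoeff q a b (m + 1) k * ((q ^ (-((m + 1 : ℕ) : ℤ)) * a - b) /
      (q ^ (-((m + 1 : ℕ) : ℤ)) * a - q ^ (-(k : ℤ)) * b)) := by
  have e1 : q ^ ((k : ℤ) - m) = q ^ k / q ^ m := by rw [zpow_sub₀ hq]; simp
  have e2 : q ^ ((k : ℤ) - (m + 1 : ℕ)) = q ^ k / (q ^ m * q) := by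
    rw [zpow_sub₀ hq, zpow_natCast, zpow_natCast, pow_succ]
  simp only [pairCoeff, e1, e2, zpow_neg, zpow_natCast]
  have e3 : qPoch (q ^ k / (q ^ m * q) * q * a / b) q (m + 1) =
      (1 - q ^ k * a / (q ^ m * b)) * qPoch (q ^ k / q ^ m * q * a / b) q m := by
    rw [qPoch_succ']
    congr 2 <;> field_simp
  rw [e3, qPoch_succ]
  have h1 := h k m
  have h2 := h 0 (m + 1)
  have h3 := h k (m + 1)
  have hQ : q ^ m ≠ 0 := pow_ne_zero _ hq
  have hR : q ^ k ≠ 0 := pow_ne_zero _ hq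
  simp only [pow_succ, pow_zero, one_mul] at h2 h3 ⊢
  generalize qPoch (q ^ k / q ^ m * q * a / b) q m = V
  generalize qPoch (q * b / a) q m = U
  generalize q ^ m = Q at *
  generalize q ^ k = R at *
  have f1 : (1 - q * (R⁻¹ * b) / (Q⁻¹ * a)) = (R * a - Q * q * b) / (R * a) := by field_simp
  have f2 : (1 - Q⁻¹ * a / (R⁻¹ * b)) = (Q * b - R * a) / (Q * b) := by field_simp
  have f3 : (1 - R * a / (Q * b)) = (Q * b - R * a) / (Q * b) := by field_simp
  have f4 : (1 - Q * (q * b / a)) = (a - Q * q * b) / a := by field_simp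
  have f5 : ((Q * q)⁻¹ * a - b) = (a - Q * q * b) / (Q * q) := by field_simp
  have f6 : ((Q * q)⁻¹ * a - R⁻¹ * b) = (R * a - Q * q * b) / (Q * q * R) := by field_simp
  rw [f1, f2, f3, f4, f5, f6]
  have n1 := sub_ne_zero.mpr h1.symm
  have n2 := sub_ne_zero.mpr h2
  have n3 := sub_ne_zero.mpr h3
  generalize Q * b - R * a = X at *
  generalize a - Q * q * b = Y at *
  generalize R * a - Q * q * b = Z at *
  -- If a Pochhammer symbol in a denominator vanishes, both sides are 0 by the convention `x / 0 =
  -- 0`, so its non-vanishing need not be proved.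
  by_cases hU : U = 0
  · simp [hU]
  by_cases hV : V = 0
  · simp [hV]
  field_simp

/-- Raising the larger index produces the same Lagrange factor as `pairCoeff_left_step`, now without
a Pieri factor. -/
theorem pairCoeff_right_step {q a b : K} (hq : q ≠ 0) (ha : a ≠ 0) (hb : b ≠ 0)
    (h : ∀ m k : ℕ, q ^ m * a ≠ q ^ k * b) (m k : ℕ) :
    pairCoeff q a b m k =
    pairCoeff q a b m (k + 1) * ((q ^ (-((k + 1 : ℕ) : ℤ)) * b - a) /
      (q ^ (-((k + 1 : ℕ) : ℤ)) * b - q ^ (-(m : ℤ)) * a)) := by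
  have e1 : q ^ ((k : ℤ) - m) = q ^ k / q ^ m := by rw [zpow_sub₀ hq]; simp
  have e2 : q ^ (((k + 1 : ℕ) : ℤ) - m) = q ^ k * q / q ^ m := by
    rw [zpow_sub₀ hq, zpow_natCast, zpow_natCast, pow_succ]
  simp only [pairCoeff, e1, e2, zpow_neg, zpow_natCast]
  have hQ : q ^ m ≠ 0 := pow_ne_zero _ hq
  have hR : q ^ k ≠ 0 := pow_ne_zero _ hq
  have key := qPoch_mul_one_sub (q ^ k / q ^ m * q * a / b) q m
  have e3 : q * (q ^ k / q ^ m * q * a / b) = q ^ k * q / q ^ m * q * a / b := by ring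
  rw [e3] at key
  have h1 := h (k + 1) m
  have h2 := h (k + 1) 0
  simp only [pow_succ, pow_zero, one_mul] at h1 h2 ⊢
  generalize qPoch (q ^ k / q ^ m * q * a / b) q m = V at *
  generalize qPoch (q ^ k * q / q ^ m * q * a / b) q m = W at *
  generalize qPoch (q * b / a) q m = U
  generalize q ^ m = Q at *
  generalize q ^ k = R at *
  have f5 : ((R * q)⁻¹ * b - a) = (b - R * q * a) / (R * q) := by field_simp
  have f6 : ((R * q)⁻¹ * b - Q⁻¹ * a) = (Q * b - R * q * a) / (Q * q * R) := by field_simp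
  have f1 : 1 - Q * (R / Q * q * a / b) = (b - R * q * a) / b := by field_simp
  have f2 : 1 - R / Q * q * a / b = (Q * b - R * q * a) / (Q * b) := by field_simp
  rw [f5, f6]
  rw [f1, f2] at key
  have n1 := sub_ne_zero.mpr h1.symm
  have n2 := sub_ne_zero.mpr h2.symm
  generalize b - R * q * a = Y at *
  generalize Q * b - R * q * a = Z at *
  have kv : V = Z / (Q * Y) * W := by field_simp at key ⊢; linear_combination key
  rw [kv]
  by_cases hU : U = 0
  · simp [hU]
  by_cases hW : W = 0
  · simp [hW]
  field_simp

/-- Here the parameter itself is divided by `q`. The outcome `(1 - s_i/t_j)/(1 - s_i/s_j)` is a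
factor of `pieriWeight`, that is, of an interpolation weight at the nodes `s_i⁻¹`. -/
theorem pairCoeff_left_shift {q a b : K} (hq : q ≠ 0) (ha : a ≠ 0) (hb : b ≠ 0)
    (h : ∀ m k : ℕ, q ^ m * a ≠ q ^ k * b) (m k : ℕ) :
    pairCoeff q (q⁻¹ * a) b m k * (q / ((1 - q * b / a) * (1 - a / b))) =
    pairCoeff q a b (m + 1) k * ((1 - a / (q ^ (-(k : ℤ)) * b)) / (1 - a / b)) := by
  have e1 : q ^ ((k : ℤ) - m) = q ^ k / q ^ m := by rw [zpow_sub₀ hq]; simp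
  have e2 : q ^ ((k : ℤ) - (m + 1 : ℕ)) = q ^ k / (q ^ m * q) := by
    rw [zpow_sub₀ hq, zpow_natCast, zpow_natCast, pow_succ]
  simp only [pairCoeff, e1, e2, zpow_neg, zpow_natCast]
  have hQ : q ^ m ≠ 0 := pow_ne_zero _ hq
  have hR : q ^ k ≠ 0 := pow_ne_zero _ hq
  have e3 : qPoch (q ^ k / (q ^ m * q) * q * a / b) q (m + 1) =
      qPoch (q ^ k / q ^ m * a / b) q m * (1 - q ^ k * a / b) := by
    rw [qPoch_succ]
    congr 2 <;> field_simp
  have e4 : qPoch (q * b / a) q (m + 1) = (1 - q * b / a) * qPoch (q * b / (q⁻¹ * a)) q m := by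
    rw [qPoch_succ']
    congr 2; field_simp
  have e5 : q ^ k / q ^ m * q * (q⁻¹ * a) / b = q ^ k / q ^ m * a / b := by field_simp
  rw [e3, e4, e5]
  have h1 := h 0 1
  have h2 := h 0 0
  have h3 := h k 0
  simp only [pow_succ, pow_zero, one_mul] at h1 h2 h3 ⊢
  have n1 : 1 - q * b / a ≠ 0 := by
    rw [sub_ne_zero]; intro e; apply h1; field_simp at e; exact e
  have n2 : 1 - a / b ≠ 0 := by
    rw [sub_ne_zero]; intro e; apply h2; field_simp at e; exact e.symm
  have n3 : 1 - q ^ k * a / b ≠ 0 := by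
    rw [sub_ne_zero]; intro e; apply h3; field_simp at e; exact e.symm
  have f : a / ((q ^ k)⁻¹ * b) = q ^ k * a / b := by field_simp
  rw [f]
  generalize 1 - q ^ k * a / b = X at *
  generalize 1 - q * b / a = Y at *
  generalize 1 - a / b = Z at *
  generalize qPoch (q ^ k / q ^ m * a / b) q m = V
  generalize qPoch (q * b / (q⁻¹ * a)) q m = U
  by_cases hU : U = 0
  · simp [hU]
  by_cases hV : V = 0
  · simp [hV]
  field_simp

theorem pairCoeff_right_shift {q a b : K} (hq : q ≠ 0) (ha : a ≠ 0) (hb : b ≠ 0)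
    (h : ∀ m k : ℕ, q ^ m * a ≠ q ^ k * b) (m k : ℕ) :
    pairCoeff q a (q⁻¹ * b) m k =
    pairCoeff q a b m (k + 1) * ((1 - b / (q ^ (-(m : ℤ)) * a)) / (1 - b / a)) := by
  have e1 : q ^ ((k : ℤ) - m) = q ^ k / q ^ m := by rw [zpow_sub₀ hq]; simp
  have e2 : q ^ (((k + 1 : ℕ) : ℤ) - m) = q ^ k * q / q ^ m := by
    rw [zpow_sub₀ hq, zpow_natCast, zpow_natCast, pow_succ]
  simp only [pairCoeff, e1, e2, zpow_neg, zpow_natCast]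
  have hQ : q ^ m ≠ 0 := pow_ne_zero _ hq
  have e3 : q ^ k / q ^ m * q * a / (q⁻¹ * b) = q ^ k * q / q ^ m * q * a / b := by
    field_simp
  have e4 : q * (q⁻¹ * b) / a = b / a := by field_simp
  rw [e3, e4]
  have key := qPoch_mul_one_sub (b / a) q m
  rw [← mul_div_assoc q b a] at key
  have f : b / ((q ^ m)⁻¹ * a) = q ^ m * (b / a) := by field_simp
  rw [f]
  have n1 : 1 - b / a ≠ 0 := by
    rw [sub_ne_zero]; intro e; apply h 0 0; field_simp at e; simpa using e
  have n2 : 1 - q ^ m * (b / a) ≠ 0 := by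
    rw [sub_ne_zero]; intro e; apply h 0 m; field_simp at e; simpa using e
  generalize 1 - q ^ m * (b / a) = X at *
  generalize 1 - b / a = Z at *
  generalize qPoch (q ^ k * q / q ^ m * q * a / b) q m = V
  generalize qPoch (b / a) q m = U at *
  generalize qPoch (q * b / a) q m = W at *
  have kv : U = Z / X * W := by field_simp; linear_combination key
  rw [kv]
  by_cases hV : V = 0
  · simp [hV]
  by_cases hW : W = 0
  · simp [hW]
  field_simp

/-! ### Two Lagrange interpolation identities -/

/-- Lagrange interpolation of a monic polynomial of degree one less than the number of nodes. -/
theorem sum_prod_sub_div_prod_sub {n : ℕ} (u : Fin (n + 1) → K) (hu : Function.Injective u)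
    (w : Fin n → K) :
    ∑ i, (∏ j, (u i - w j)) / ∏ j with j ≠ i, (u i - u j) = 1 := by
  classical
  have hm : (∏ j, (Polynomial.X - Polynomial.C (w j))).Monic :=
    Polynomial.monic_prod_X_sub_C w Finset.univ
  have hdeg : (∏ j, (Polynomial.X - Polynomial.C (w j))).natDegree = n := by
    simp [Polynomial.natDegree_finsetProd_X_sub_C_eq_card]
  have := Lagrange.leadingCoeff_eq_sum (s := Finset.univ) (v := u) hu.injOn
    (P := ∏ j, (Polynomial.X - Polynomial.C (w j)))
    (by rw [Polynomial.degree_eq_natDegree hm.ne_zero, hdeg]; simp)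
  rw [hm.leadingCoeff] at this
  rw [this]
  refine Finset.sum_congr rfl fun i _ => ?_
  simp only [Polynomial.eval_prod, Polynomial.eval_sub, Polynomial.eval_X, Polynomial.eval_C]
  congr 2
  ext j; simp

/-- Lagrange interpolation of a monic polynomial of degree equal to the number of nodes. -/
theorem sum_prod_sub_div_prod_sub_eq_sum_sub {n : ℕ} (u : Fin n → K) (hu : Function.Injective u)
    (w : Fin n → K) :
    ∑ i, (∏ j, (u i - w j)) / ∏ j with j ≠ i, (u i - u j) = ∑ i, u i - ∑ i, w i := by
  classical
  cases n with
  | zero => simp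
  | succ n =>
    set P : (Fin (n + 1) → K) → Polynomial K :=
      fun v => ∏ j, (Polynomial.X - Polynomial.C (v j)) with hP
    have hm : ∀ v, (P v).Monic := fun v => Polynomial.monic_prod_X_sub_C v Finset.univ
    have hdeg : ∀ v, (P v).degree = (n + 1 : ℕ) := fun v => by
      rw [Polynomial.degree_eq_natDegree (hm v).ne_zero,
        Polynomial.natDegree_finsetProd_X_sub_C_eq_card]
      simp
    have hc : ∀ v, (P v).coeff n = - ∑ i, v i := fun v => by
      have := Polynomial.prod_X_sub_C_coeff_card_pred Finset.univ v (by simp)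
      simpa using this
    -- Subtracting the nodal polynomial `P u` lowers the degree below the number of nodes and leaves
    -- the values at the nodes unchanged; the coefficient of `X^n` becomes `∑ u - ∑ w`.
    have := Lagrange.coeff_eq_sum (s := Finset.univ) (v := u) hu.injOn (P := P w - P u)
      (by
        have := Polynomial.degree_sub_lt_left (p := P w) (q := P u) (by rw [hdeg, hdeg])
          (hm w).ne_zero (by rw [(hm w).leadingCoeff, (hm u).leadingCoeff])
        rw [hdeg] at this
        simpa using this)
    simp only [Finset.card_univ, Fintype.card_fin, Nat.add_sub_cancel, Polynomial.coeff_sub,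
      hc] at this
    rw [show ∑ i, u i - ∑ i, w i = -∑ i, w i - -∑ i, u i by ring, this]
    refine Finset.sum_congr rfl fun i _ => ?_
    have h0 : ∏ j, (u i - u j) = 0 := Finset.prod_eq_zero (Finset.mem_univ i) (sub_self _)
    simp only [hP, Polynomial.eval_prod, Polynomial.eval_sub, Polynomial.eval_X,
      Polynomial.eval_C, h0, sub_zero]
    congr 2
    ext j; simp

end

end QToda

/-! ### A-type branching coefficients and interpolation weights -/

namespace QToda

noncomputable section

variable {K : Type*} [Field K]

theorem prod_eq_of_eq_off {ι : Type*} [Fintype ι] [DecidableEq ι] (i : ι) {φ ψ : ι → K} {x y : K}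
    (h : ∀ j, j ≠ i → φ j = ψ j) (hi : φ i * x = ψ i * y) :
    (∏ j, φ j) * x = (∏ j, ψ j) * y := by
  rw [← Finset.mul_prod_erase _ φ (Finset.mem_univ i),
    ← Finset.mul_prod_erase _ ψ (Finset.mem_univ i),
    Finset.prod_congr rfl fun j hj => h j (Finset.ne_of_mem_erase hj)]
  linear_combination (∏ j ∈ Finset.univ.erase i, ψ j) * hi

theorem prod_pairs_eq {ι : Type*} [Fintype ι] [LinearOrder ι] (i : ι) (φ : ι → ι → K) :
    ∏ a, ∏ b with a < b, φ a b =
      (∏ b with i < b, φ i b) * (∏ a with a < i, φ a i) *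
        ∏ a with a ≠ i, ∏ b with a < b ∧ b ≠ i, φ a b := by
  rw [← Finset.mul_prod_erase _ (fun a => ∏ b with a < b, φ a b) (Finset.mem_univ i), mul_assoc]
  congr 1
  have h1 : ∀ a, ∏ b with a < b, φ a b =
      (if a < i then φ a i else 1) * ∏ b with a < b ∧ b ≠ i, φ a b := by
    intro a
    by_cases ha : a < i
    · rw [if_pos ha, ← Finset.mul_prod_erase _ (φ a) (Finset.mem_filter.mpr ⟨Finset.mem_univ i, ha⟩)]
      congr 2
      ext b; simp [and_comm]
    · rw [if_neg ha, one_mul]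
      refine Finset.prod_congr ?_ fun _ _ => rfl
      ext b
      simp only [Finset.mem_filter, Finset.mem_univ, true_and]
      exact ⟨fun h => ⟨h, fun e => ha (e ▸ h)⟩, fun h => h.1⟩
  rw [Finset.prod_congr rfl fun a _ => h1 a, Finset.prod_mul_distrib, ← Finset.prod_filter]
  congr 1
  · refine Finset.prod_congr ?_ fun _ _ => rfl
    ext b
    simp only [Finset.mem_filter, Finset.mem_univ, Finset.mem_erase, true_and, and_true]
    exact ⟨fun h => h.2, fun h => ⟨h.ne, h⟩⟩
  · refine Finset.prod_congr ?_ fun _ _ => rfl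
    ext b; simp

theorem prod_ne_eq {ι : Type*} [Fintype ι] [LinearOrder ι] (i : ι) (w : ι → K) :
    ∏ j with j ≠ i, w j = (∏ j with i < j, w j) * ∏ j with j < i, w j := by
  rw [← Finset.prod_union]
  · refine Finset.prod_congr ?_ fun _ _ => rfl
    ext b
    simp only [Finset.mem_filter, Finset.mem_univ, Finset.mem_union, true_and]
    exact ⟨fun h => (lt_or_gt_of_ne h).symm, fun h => h.elim ne_of_gt ne_of_lt⟩
  · rw [Finset.disjoint_filter]
    exact fun j _ h h' => absurd h h'.not_gt

/-- Only pairs containing `i` change under a step at `i`. The factors `x` sit on pairs with `i` as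
smaller index, as in `pieriCoeff`, while the result runs over all `j ≠ i`: this turns ordered
products into symmetric Lagrange products. -/
theorem prod_pairs_mul_eq {ι : Type*} [Fintype ι] [LinearOrder ι] (i : ι) {φ ψ : ι → ι → K}
    {x w : ι → K} (h : ∀ a b, a ≠ i → b ≠ i → φ a b = ψ a b)
    (hr : ∀ b, i < b → φ i b * x b = ψ i b * w b)
    (hl : ∀ a, a < i → φ a i = ψ a i * w a) :
    (∏ a, ∏ b with a < b, φ a b) * ∏ b with i < b, x b =
      (∏ a, ∏ b with a < b, ψ a b) * ∏ j with j ≠ i, w j := by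
  have h1 : (∏ b with i < b, φ i b) * ∏ b with i < b, x b =
      (∏ b with i < b, ψ i b) * ∏ b with i < b, w b := by
    rw [← Finset.prod_mul_distrib, ← Finset.prod_mul_distrib]
    exact Finset.prod_congr rfl fun b hb => hr b (Finset.mem_filter.mp hb).2
  have h2 : ∏ a with a < i, φ a i = (∏ a with a < i, ψ a i) * ∏ a with a < i, w a := by
    rw [← Finset.prod_mul_distrib]
    exact Finset.prod_congr rfl fun b hb => hl b (Finset.mem_filter.mp hb).2
  have h3 : (∏ a with a ≠ i, ∏ b with a < b ∧ b ≠ i, φ a b) =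
      ∏ a with a ≠ i, ∏ b with a < b ∧ b ≠ i, ψ a b :=
    Finset.prod_congr rfl fun a ha => Finset.prod_congr rfl fun b hb =>
      h a b (Finset.mem_filter.mp ha).2 (Finset.mem_filter.mp hb).2.2
  rw [prod_pairs_eq i φ, prod_pairs_eq i ψ, prod_ne_eq i w, h2, h3]
  linear_combination (∏ a with a < i, ψ a i) * (∏ a with a < i, w a) *
    (∏ a with a ≠ i, ∏ b with a < b ∧ b ≠ i, ψ a b) * h1

/-- The spectral parameters `q^{-θ_i} s_i`. -/
def shiftBy {n : ℕ} (q : K) (θ : Fin n → ℕ) (s : Fin n → K) : Fin n → K :=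
  fun i => q ^ (-(θ i : ℤ)) * s i

/-- The parameters `s_i` are non-zero and their ratios are not powers of `q`. -/
structure IsGeneric {n : ℕ} (q : K) (s : Fin n → K) : Prop where
  q_ne_zero : q ≠ 0
  q_pow_ne : ∀ k : ℕ, 0 < k → q ^ k ≠ 1
  ne_zero : ∀ i, s i ≠ 0
  ratio : ∀ i j, i ≠ j → ∀ m k : ℕ, q ^ m * s i ≠ q ^ k * s j

variable {n : ℕ} {q : K} {s : Fin n → K}

theorem shiftBy_add (hq : q ≠ 0) (θ η : Fin n → ℕ) :
    shiftBy q (θ + η) s = shiftBy q θ (shiftBy q η s) := by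
  ext i
  simp only [shiftBy, Pi.add_apply, Nat.cast_add, neg_add, zpow_add₀ hq, mul_assoc]

theorem shiftBy_single_self (i : Fin n) : shiftBy q (Pi.single i 1) s i = q⁻¹ * s i := by
  simp [shiftBy]

theorem shiftBy_single_of_ne {i j : Fin n} (h : j ≠ i) :
    shiftBy q (Pi.single i 1) s j = s j := by
  simp [shiftBy, h]

theorem IsGeneric.shiftBy (h : IsGeneric q s) (θ : Fin n → ℕ) : IsGeneric q (shiftBy q θ s) where
  q_ne_zero := h.q_ne_zero
  q_pow_ne := h.q_pow_ne
  ne_zero i := mul_ne_zero (zpow_ne_zero _ h.q_ne_zero) (h.ne_zero i)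
  ratio i j hij m k e := by
    apply h.ratio i j hij (m + θ j) (k + θ i)
    have h1 : q ^ θ i ≠ 0 := pow_ne_zero _ h.q_ne_zero
    have h2 : q ^ θ j ≠ 0 := pow_ne_zero _ h.q_ne_zero
    simp only [QToda.shiftBy, zpow_neg, zpow_natCast] at e
    field_simp at e
    simp only [pow_add]
    linear_combination e

theorem IsGeneric.castSucc {s : Fin (n + 1) → K} (h : IsGeneric q s) :
    IsGeneric q fun i : Fin n => s i.castSucc where
  q_ne_zero := h.q_ne_zero
  q_pow_ne := h.q_pow_ne
  ne_zero i := h.ne_zero _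
  ratio i j hij := h.ratio _ _ fun e => hij (Fin.castSucc_injective n e)

theorem IsGeneric.injective (h : IsGeneric q s) : Function.Injective s := by
  intro i j e
  by_contra hij
  exact h.ratio i j hij 0 0 (by rw [e])

/-- The product of the pair factors over all pairs of indices. -/
def pairProd (q : K) (s : Fin n → K) (θ : Fin n → ℕ) : K :=
  ∏ i, ∏ j with i < j, pairCoeff q (s i) (s j) (θ i) (θ j)

/-- The coefficients of the Pieri-type formula for multiplication by `1 / x_n`. -/
def pieriCoeff (q : K) (s : Fin n → K) (i : Fin n) : K :=
  ∏ l with i < l, q / ((1 - q * s l / s i) * (1 - s i / s l))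

theorem add_single_self (θ : Fin n → ℕ) (i : Fin n) : (θ + Pi.single i 1 : Fin n → ℕ) i = θ i + 1 := by simp

theorem add_single_of_ne (θ : Fin n → ℕ) {i j : Fin n} (h : j ≠ i) :
    (θ + Pi.single i 1 : Fin n → ℕ) j = θ j := by simp [h]

theorem pairProd_mul_pieriCoeff_shiftBy (hs : IsGeneric q s) (θ : Fin n → ℕ) (i : Fin n)
    (t : Fin n → K) (ht : t = shiftBy q (θ + Pi.single i 1) s) :
    pairProd q s θ * pieriCoeff q (shiftBy q θ s) i =
      pairProd q s (θ + Pi.single i 1) * ∏ j with j ≠ i, (t i - s j) / (t i - t j) := by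
  refine prod_pairs_mul_eq i ?_ ?_ ?_
  · intro a b ha hb
    rw [add_single_of_ne θ ha, add_single_of_ne θ hb]
  · intro b hb
    rw [ht]
    simp only [shiftBy]
    rw [add_single_self, add_single_of_ne θ hb.ne']
    exact pairCoeff_left_step hs.q_ne_zero (hs.ne_zero _) (hs.ne_zero _)
      (hs.ratio _ _ hb.ne) _ _
  · intro a ha
    rw [ht]
    simp only [shiftBy]
    rw [add_single_self, add_single_of_ne θ ha.ne]
    exact pairCoeff_right_step hs.q_ne_zero (hs.ne_zero _) (hs.ne_zero _)
      (hs.ratio _ _ ha.ne) _ _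

theorem pairProd_shiftBy_single_mul_pieriCoeff (hs : IsGeneric q s) (θ : Fin n → ℕ) (i : Fin n)
    (t : Fin n → K) (ht : t = shiftBy q (θ + Pi.single i 1) s) :
    pairProd q (shiftBy q (Pi.single i 1) s) θ * pieriCoeff q s i =
      pairProd q s (θ + Pi.single i 1) * ∏ j with j ≠ i, (1 - s i / t j) / (1 - s i / s j) := by
  refine prod_pairs_mul_eq i ?_ ?_ ?_
  · intro a b ha hb
    rw [add_single_of_ne θ ha, add_single_of_ne θ hb, shiftBy_single_of_ne ha,
      shiftBy_single_of_ne hb]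
  · intro b hb
    rw [ht, shiftBy_single_self, shiftBy_single_of_ne hb.ne']
    simp only [shiftBy]
    rw [add_single_self, add_single_of_ne θ hb.ne']
    exact pairCoeff_left_shift hs.q_ne_zero (hs.ne_zero _) (hs.ne_zero _)
      (hs.ratio _ _ hb.ne) _ _
  · intro a ha
    rw [ht, shiftBy_single_self, shiftBy_single_of_ne ha.ne]
    simp only [shiftBy]
    rw [add_single_self, add_single_of_ne θ ha.ne]
    exact pairCoeff_right_shift hs.q_ne_zero (hs.ne_zero _) (hs.ne_zero _)
      (hs.ratio _ _ ha.ne) _ _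

/-- The factor of the branching coefficient of the `A`-type Toda function attached to a
single index. -/
def singleCoeff (q a c : K) (m : ℕ) : K :=
  q ^ m / (qPoch q q m * qPoch (q * c / a) q m)

theorem singleCoeff_step {q a c : K} (hq : q ≠ 0) (hq' : ∀ k : ℕ, 0 < k → q ^ k ≠ 1) (ha : a ≠ 0)
    (h : ∀ m k : ℕ, q ^ m * a ≠ q ^ k * c) (m : ℕ) :
    singleCoeff q a c m = singleCoeff q a c (m + 1) *
      (q⁻¹ * ((1 - a / (q ^ (-((m + 1 : ℕ) : ℤ)) * a)) *
        (1 - c / (q ^ (-((m + 1 : ℕ) : ℤ)) * a)))) := by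
  simp only [singleCoeff, zpow_neg, zpow_natCast, qPoch_succ, pow_succ]
  have hQ : q ^ m ≠ 0 := pow_ne_zero _ hq
  have n1 := sub_ne_zero.mpr (hq' (m + 1) (by omega)).symm
  have n2 := sub_ne_zero.mpr (h 0 (m + 1))
  simp only [pow_succ, pow_zero, one_mul] at n1 n2
  have f1 : 1 - a / ((q ^ m * q)⁻¹ * a) = 1 - q ^ m * q := by field_simp
  have f2 : 1 - c / ((q ^ m * q)⁻¹ * a) = (a - q ^ m * q * c) / a := by field_simp
  have f3 : 1 - q ^ m * (q * c / a) = (a - q ^ m * q * c) / a := by field_simp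
  rw [f1, f2, f3]
  generalize 1 - q ^ m * q = X at *
  generalize a - q ^ m * q * c = Y at *
  generalize qPoch q q m = U
  generalize qPoch (q * c / a) q m = V
  by_cases hU : U = 0
  · simp [hU]
  by_cases hV : V = 0
  · simp [hV]
  field_simp

theorem singleCoeff_left_shift {q a c : K} (hq : q ≠ 0) (hq' : ∀ k : ℕ, 0 < k → q ^ k ≠ 1)
    (ha : a ≠ 0) (h : ∀ m k : ℕ, q ^ m * a ≠ q ^ k * c) (m : ℕ) :
    singleCoeff q (q⁻¹ * a) c m * (q / ((1 - q * c / a) * (1 - a / c))) =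
      singleCoeff q a c (m + 1) *
        ((1 - a / (q ^ (-((m + 1 : ℕ) : ℤ)) * a)) / (1 - a / c)) := by
  simp only [singleCoeff, zpow_neg, zpow_natCast]
  have hQ : q ^ m ≠ 0 := pow_ne_zero _ hq
  rw [qPoch_succ' (q * c / a), qPoch_succ]
  have e : q * (q * c / a) = q * c / (q⁻¹ * a) := by field_simp
  rw [e]
  have n1 := sub_ne_zero.mpr (hq' (m + 1) (by omega)).symm
  have n2 : 1 - q * c / a ≠ 0 := by
    rw [sub_ne_zero]; intro e; apply h 0 1; field_simp at e; simpa using e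
  simp only [pow_succ] at n1 ⊢
  have f1 : 1 - a / ((q ^ m * q)⁻¹ * a) = 1 - q ^ m * q := by field_simp
  rw [f1]
  generalize 1 - q ^ m * q = X at *
  generalize 1 - q * c / a = Y at *
  generalize qPoch q q m = U
  generalize qPoch (q * c / (q⁻¹ * a)) q m = V
  generalize 1 - a / c = Z
  by_cases hU : U = 0
  · simp [hU]
  by_cases hV : V = 0
  · simp [hV]
  by_cases hZ : Z = 0
  · simp [hZ]
  field_simp

theorem singleCoeff_right_shift {q a c : K} (hq : q ≠ 0) (ha : a ≠ 0)
    (h : ∀ m k : ℕ, q ^ m * a ≠ q ^ k * c) (m : ℕ) :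
    singleCoeff q a (q⁻¹ * c) m =
      singleCoeff q a c m * ((1 - c / (q ^ (-(m : ℤ)) * a)) / (1 - c / a)) := by
  simp only [singleCoeff, zpow_neg, zpow_natCast]
  have hQ : q ^ m ≠ 0 := pow_ne_zero _ hq
  have e4 : q * (q⁻¹ * c) / a = c / a := by field_simp
  rw [e4]
  have key := qPoch_mul_one_sub (c / a) q m
  rw [← mul_div_assoc q c a] at key
  have f : c / ((q ^ m)⁻¹ * a) = q ^ m * (c / a) := by field_simp
  rw [f]
  have n1 : 1 - c / a ≠ 0 := by
    rw [sub_ne_zero]; intro e; apply h 0 0; field_simp at e; simpa using e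
  have n2 : 1 - q ^ m * (c / a) ≠ 0 := by
    rw [sub_ne_zero]; intro e; apply h 0 m; field_simp at e; simpa using e
  generalize 1 - q ^ m * (c / a) = X at *
  generalize 1 - c / a = Z at *
  generalize qPoch q q m = V
  generalize qPoch (c / a) q m = U at *
  generalize qPoch (q * c / a) q m = W at *
  have kv : U = Z / X * W := by field_simp; linear_combination key
  rw [kv]
  by_cases hV : V = 0
  · simp [hV]
  by_cases hW : W = 0
  · simp [hW]
  field_simp

/-- The branching coefficient from the `A`-type Toda function in `n + 1` variables to the one
in `n` variables. -/
def branchCoeffA (q : K) (s : Fin (n + 1) → K) (θ : Fin n → ℕ) : K :=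
  (∏ i : Fin n, singleCoeff q (s i.castSucc) (s (Fin.last n)) (θ i)) *
    pairProd q (fun i => s i.castSucc) θ

/-- The weights in the Lagrange interpolation formula behind the Pieri-type formula. -/
def pieriWeight (s : Fin (n + 1) → K) (t : Fin n → K) (i : Fin (n + 1)) : K :=
  (∏ j, (1 - s i / t j)) / ∏ j with j ≠ i, (1 - s i / s j)

/-- The weights in the Lagrange interpolation formula behind the eigenvalue equations. -/
def eigenWeight (s t : Fin n → K) (i : Fin n) : K :=
  (∏ j, (t i - s j)) / (t i * ∏ j with j ≠ i, (t i - t j))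

theorem prod_ne_mul {ι : Type*} [Fintype ι] [DecidableEq ι] (i : ι) (w : ι → K) :
    w i * ∏ j with j ≠ i, w j = ∏ j, w j := by
  rw [← Finset.mul_prod_erase _ w (Finset.mem_univ i)]
  congr 2
  ext j; simp

/-- The pair factors give the Lagrange product over `j ≠ i`. The single factor contributes the
missing `j = i` term `1 - s_i/t_i`, coming from `(q;q)`, and the term of the last parameter. -/
theorem branchCoeffA_mul_pieriCoeff_shiftBy {s : Fin (n + 1) → K} (hs : IsGeneric q s)
    (θ : Fin n → ℕ) (i : Fin n) (t : Fin n → K)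
    (ht : t = shiftBy q (θ + Pi.single i 1) fun i => s i.castSucc) :
    branchCoeffA q s θ * pieriCoeff q (shiftBy q θ fun i => s i.castSucc) i =
      branchCoeffA q s (θ + Pi.single i 1) *
        (q⁻¹ * ((1 - s (Fin.last n) / t i) * eigenWeight (fun i => s i.castSucc) t i)) := by
  have h1 := pairProd_mul_pieriCoeff_shiftBy hs.castSucc θ i t ht
  have h2 : (∏ i : Fin n, singleCoeff q (s i.castSucc) (s (Fin.last n)) (θ i)) * 1 =
      (∏ j : Fin n, singleCoeff q (s j.castSucc) (s (Fin.last n)) ((θ + Pi.single i 1 : Fin n → ℕ) j)) *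
        (q⁻¹ * ((1 - s i.castSucc / t i) * (1 - s (Fin.last n) / t i))) := by
    refine prod_eq_of_eq_off i (fun j hj => by rw [add_single_of_ne θ hj]) ?_
    rw [ht, mul_one]
    simp only [shiftBy]
    rw [add_single_self]
    exact singleCoeff_step hs.q_ne_zero hs.q_pow_ne (hs.ne_zero _)
      (hs.ratio _ _ (Fin.castSucc_lt_last i).ne) _
  have ht0 : t i ≠ 0 := by rw [ht]; exact (hs.castSucc.shiftBy _).ne_zero i
  have h3 : eigenWeight (fun i => s i.castSucc) t i =
      (1 - s i.castSucc / t i) * ∏ j with j ≠ i, (t i - s j.castSucc) / (t i - t j) := by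
    rw [eigenWeight, ← prod_ne_mul i, Finset.prod_div_distrib]
    field_simp
  rw [branchCoeffA, branchCoeffA, h3]
  rw [mul_one] at h2
  rw [mul_assoc, h1, h2]
  ring

theorem pieriCoeff_castSucc (s : Fin (n + 1) → K) (i : Fin n) :
    pieriCoeff q s i.castSucc = pieriCoeff q (fun i => s i.castSucc) i *
      (q / ((1 - q * s (Fin.last n) / s i.castSucc) * (1 - s i.castSucc / s (Fin.last n)))) := by
  simp only [pieriCoeff, Finset.prod_filter, Fin.prod_univ_castSucc, Fin.castSucc_lt_last, if_true,
    Fin.castSucc_lt_castSucc_iff]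

theorem pieriCoeff_last (s : Fin (n + 1) → K) : pieriCoeff q s (Fin.last n) = 1 := by
  rw [pieriCoeff, Finset.prod_filter]
  exact Finset.prod_eq_one fun j _ => if_neg (Fin.le_last j).not_gt

theorem shiftBy_single_castSucc (s : Fin (n + 1) → K) (i : Fin n) :
    (fun j : Fin n => shiftBy q (Pi.single i.castSucc 1) s j.castSucc) =
      shiftBy q (Pi.single i 1) fun j => s j.castSucc := by
  ext j
  simp only [shiftBy, Pi.single_apply, Fin.castSucc_inj]

theorem branchCoeffA_shiftBy_single_mul_pieriCoeff {s : Fin (n + 1) → K} (hs : IsGeneric q s)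
    (θ : Fin n → ℕ) (i : Fin n) (t : Fin n → K)
    (ht : t = shiftBy q (θ + Pi.single i 1) fun i => s i.castSucc) :
    branchCoeffA q (shiftBy q (Pi.single i.castSucc 1) s) θ * pieriCoeff q s i.castSucc =
      branchCoeffA q s (θ + Pi.single i 1) * pieriWeight s t i.castSucc := by
  have h1 := pairProd_shiftBy_single_mul_pieriCoeff hs.castSucc θ i t ht
  have h2 : (∏ j : Fin n, singleCoeff q (shiftBy q (Pi.single i.castSucc 1) s j.castSucc)
        (s (Fin.last n)) (θ j)) *
        (q / ((1 - q * s (Fin.last n) / s i.castSucc) *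
          (1 - s i.castSucc / s (Fin.last n)))) =
      (∏ j : Fin n, singleCoeff q (s j.castSucc) (s (Fin.last n)) ((θ + Pi.single i 1 : Fin n → ℕ) j)) *
        ((1 - s i.castSucc / t i) / (1 - s i.castSucc / s (Fin.last n))) := by
    refine prod_eq_of_eq_off i (fun j hj => ?_) ?_
    · rw [add_single_of_ne θ hj, shiftBy_single_of_ne]
      exact fun e => hj (Fin.castSucc_injective n e)
    · rw [ht, shiftBy_single_self]
      simp only [shiftBy]
      rw [add_single_self]
      exact singleCoeff_left_shift hs.q_ne_zero hs.q_pow_ne (hs.ne_zero _)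
        (hs.ratio _ _ (Fin.castSucc_lt_last i).ne) _
  have h3 : pieriWeight s t i.castSucc =
      ((1 - s i.castSucc / t i) / (1 - s i.castSucc / s (Fin.last n))) *
        ∏ j with j ≠ i, (1 - s i.castSucc / t j) / (1 - s i.castSucc / s j.castSucc) := by
    have : ∏ j with j ≠ i.castSucc, (1 - s i.castSucc / s j) =
        (1 - s i.castSucc / s (Fin.last n)) *
          ∏ j with j ≠ i, (1 - s i.castSucc / s j.castSucc) := by
      simp [Finset.prod_filter, Fin.prod_univ_castSucc, mul_comm, (Fin.castSucc_lt_last i).ne']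
    rw [pieriWeight, this, ← prod_ne_mul i, Finset.prod_div_distrib, mul_div_mul_comm]
  rw [branchCoeffA, branchCoeffA, h3, shiftBy_single_castSucc, pieriCoeff_castSucc,
    shiftBy_single_of_ne (Fin.castSucc_lt_last i).ne']
  linear_combination (pairProd q (shiftBy q (Pi.single i 1) fun j => s j.castSucc) θ *
    pieriCoeff q (fun i => s i.castSucc) i) * h2 + (∏ j : Fin n, singleCoeff q (s j.castSucc)
    (s (Fin.last n)) ((θ + Pi.single i 1 : Fin n → ℕ) j)) * ((1 - s i.castSucc / t i) /
    (1 - s i.castSucc / s (Fin.last n))) * h1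

theorem branchCoeffA_shiftBy_single_last {s : Fin (n + 1) → K} (hs : IsGeneric q s)
    (θ : Fin n → ℕ) (t : Fin n → K) (ht : t = shiftBy q θ fun i => s i.castSucc) :
    branchCoeffA q (shiftBy q (Pi.single (Fin.last n) 1) s) θ =
      branchCoeffA q s θ * pieriWeight s t (Fin.last n) := by
  have h0 : ∀ j : Fin n, shiftBy q (Pi.single (Fin.last n) 1) s j.castSucc = s j.castSucc :=
    fun j => shiftBy_single_of_ne (Fin.castSucc_lt_last j).ne
  have h1 : ∏ j with j ≠ Fin.last n, (1 - s (Fin.last n) / s j) =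
      ∏ j : Fin n, (1 - s (Fin.last n) / s j.castSucc) := by
    simp [Finset.prod_filter, Fin.prod_univ_castSucc]
  rw [branchCoeffA, branchCoeffA, pieriWeight, h1, ← Finset.prod_div_distrib]
  simp only [h0, shiftBy_single_self]
  rw [mul_right_comm, ← Finset.prod_mul_distrib]
  congr 1
  refine Finset.prod_congr rfl fun j _ => ?_
  rw [ht]
  exact singleCoeff_right_shift hs.q_ne_zero (hs.ne_zero _)
    (hs.ratio _ _ (Fin.castSucc_lt_last j).ne) _

theorem card_filter_ne (i : Fin (n + 1)) : (Finset.univ.filter fun j => j ≠ i).card = n := by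
  rw [Finset.filter_ne', Finset.card_erase_of_mem (Finset.mem_univ i)]
  simp

/-- Interpolation of `∏ (z - t_j⁻¹)` at the `n + 1` nodes `s_i⁻¹`; the powers of `s_i` cancel. -/
theorem sum_pieriWeight {s : Fin (n + 1) → K} {t : Fin n → K} (hs : Function.Injective s)
    (hs0 : ∀ i, s i ≠ 0) : ∑ i, pieriWeight s t i = 1 := by
  rw [← sum_prod_sub_div_prod_sub (fun i => (s i)⁻¹) (fun i j e => hs (inv_injective e))
    (fun i => (t i)⁻¹)]
  refine Finset.sum_congr rfl fun i _ => ?_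
  have h1 : ∏ j, ((s i)⁻¹ - (t j)⁻¹) = ((s i)⁻¹) ^ n * ∏ j, (1 - s i / t j) := by
    have : ∀ j, (s i)⁻¹ - (t j)⁻¹ = (s i)⁻¹ * (1 - s i / t j) := fun j => by
      rw [mul_sub, mul_one, ← mul_div_assoc, inv_mul_cancel₀ (hs0 i), one_div]
    simp_rw [this, Finset.prod_mul_distrib]
    simp
  have h2 : ∏ j with j ≠ i, ((s i)⁻¹ - (s j)⁻¹) =
      ((s i)⁻¹) ^ n * ∏ j with j ≠ i, (1 - s i / s j) := by
    have : ∀ j, (s i)⁻¹ - (s j)⁻¹ = (s i)⁻¹ * (1 - s i / s j) := fun j => by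
      rw [mul_sub, mul_one, ← mul_div_assoc, inv_mul_cancel₀ (hs0 i), one_div]
    simp_rw [this, Finset.prod_mul_distrib, Finset.prod_const, card_filter_ne]
  rw [h1, h2, pieriWeight, mul_div_mul_left _ _ (pow_ne_zero _ (inv_ne_zero (hs0 i)))]

/-- Interpolation of `∏ (z - t_j)` at the nodes `s_i`: the extra `s_i` completes `∏_{j ≠ i} s_j` to
the full product. -/
theorem sum_mul_pieriWeight {s : Fin (n + 1) → K} {t : Fin n → K} (hs : Function.Injective s)
    (hs0 : ∀ i, s i ≠ 0) (ht0 : ∀ i, t i ≠ 0) :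
    ∑ i, s i * pieriWeight s t i = (∏ i, s i) / ∏ i, t i := by
  rw [← mul_one ((∏ i, s i) / ∏ i, t i), ← sum_prod_sub_div_prod_sub s hs t, Finset.mul_sum]
  refine Finset.sum_congr rfl fun i _ => ?_
  have h1 : ∏ j, (1 - s i / t j) = (-1) ^ n * (∏ j, (s i - t j)) / ∏ j, t j := by
    have : ∀ j, 1 - s i / t j = (-1) * (s i - t j) / t j := fun j => by
      have := ht0 j
      field_simp; ring
    simp_rw [this, Finset.prod_div_distrib, Finset.prod_mul_distrib]
    simp
  have h2 : ∏ j with j ≠ i, (1 - s i / s j) =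
      (-1) ^ n * (∏ j with j ≠ i, (s i - s j)) / ∏ j with j ≠ i, s j := by
    have : ∀ j, 1 - s i / s j = (-1) * (s i - s j) / s j := fun j => by
      have := hs0 j
      field_simp; ring
    simp_rw [this, Finset.prod_div_distrib, Finset.prod_mul_distrib, Finset.prod_const,
      card_filter_ne]
  have h3 : ∏ j with j ≠ i, (s i - s j) ≠ 0 := Finset.prod_ne_zero_iff.mpr fun j hj =>
    sub_ne_zero.mpr fun e => (Finset.mem_filter.mp hj).2 (hs e).symm
  have h4 : ∏ j, t j ≠ 0 := Finset.prod_ne_zero_iff.mpr fun j _ => ht0 j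
  have h5 : ∏ j with j ≠ i, s j ≠ 0 := Finset.prod_ne_zero_iff.mpr fun j _ => hs0 j
  rw [pieriWeight, h1, h2, ← prod_ne_mul i s]
  have h6 : ((-1 : K)) ^ n ≠ 0 := pow_ne_zero _ (by simp)
  field_simp

theorem sum_mul_eigenWeight {s t : Fin n → K} (ht : Function.Injective t) (ht0 : ∀ i, t i ≠ 0) :
    ∑ i, t i * eigenWeight s t i = ∑ i, t i - ∑ i, s i := by
  rw [← sum_prod_sub_div_prod_sub_eq_sum_sub t ht s]
  refine Finset.sum_congr rfl fun i _ => ?_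
  rw [eigenWeight, ← mul_div_assoc, mul_div_mul_left _ _ (ht0 i)]

/-- The factor `t_i` in the denominator of the weight comes from an additional node 0, whose own
term is `∏ s / ∏ t`. -/
theorem sum_eigenWeight {s t : Fin n → K} (ht : Function.Injective t) (ht0 : ∀ i, t i ≠ 0) :
    ∑ i, eigenWeight s t i = 1 - (∏ i, s i) / ∏ i, t i := by
  have h := sum_prod_sub_div_prod_sub (Fin.cons 0 t : Fin (n + 1) → K)
    (Fin.cons_injective_iff.mpr ⟨fun ⟨i, hi⟩ => ht0 i hi, ht⟩) s
  rw [Fin.sum_univ_succ] at h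
  simp only [Finset.prod_filter, Fin.prod_univ_succ, Fin.cons_zero, Fin.cons_succ, ne_eq,
    not_true_eq_false, if_false, Fin.succ_ne_zero, not_false_eq_true, if_true, zero_sub, sub_zero,
    one_mul, (Fin.succ_ne_zero _).symm, Fin.succ_inj] at h
  simp only [eigenWeight, Finset.prod_filter, ne_eq]
  have hneg : (∏ x, -s x) / ∏ x, -t x = (∏ x, s x) / ∏ x, t x := by
    rw [← Finset.prod_div_distrib, ← Finset.prod_div_distrib]
    exact Finset.prod_congr rfl fun x _ => neg_div_neg_eq _ _
  rw [hneg] at h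
  linear_combination h

theorem sum_eigenWeight_div {s t : Fin n → K} (ht : Function.Injective t) (hs0 : ∀ i, s i ≠ 0)
    (ht0 : ∀ i, t i ≠ 0) :
    ∑ i, eigenWeight s t i / t i =
      -((∏ i, s i) / ∏ i, t i) * (∑ i, (t i)⁻¹ - ∑ i, (s i)⁻¹) := by
  rw [← sum_prod_sub_div_prod_sub_eq_sum_sub (fun i => (t i)⁻¹)
    (fun i j e => ht (inv_injective e)) (fun i => (s i)⁻¹), Finset.mul_sum]
  refine Finset.sum_congr rfl fun i _ => ?_
  have h1 : ∏ j, ((t i)⁻¹ - (s j)⁻¹) =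
      (-(t i)⁻¹) ^ n * (∏ j, (t i - s j)) / ∏ j, s j := by
    have : ∀ j, (t i)⁻¹ - (s j)⁻¹ = -(t i)⁻¹ * (t i - s j) / s j := fun j => by
      have := hs0 j
      have := ht0 i
      field_simp; ring
    simp_rw [this, Finset.prod_div_distrib, Finset.prod_mul_distrib]
    simp
  -- The extra factor raises the exponent from `n - 1` to `n`, so that it cancels against `h1`
  -- without truncated subtraction.
  have h2 : (-(t i)⁻¹) * ∏ j with j ≠ i, ((t i)⁻¹ - (t j)⁻¹) =
      (-(t i)⁻¹) ^ n * (∏ j with j ≠ i, (t i - t j)) / ∏ j with j ≠ i, t j := by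
    have : ∀ j, (t i)⁻¹ - (t j)⁻¹ = -(t i)⁻¹ * (t i - t j) / t j := fun j => by
      have := ht0 j
      have := ht0 i
      field_simp; ring
    simp_rw [this, Finset.prod_div_distrib, Finset.prod_mul_distrib, Finset.prod_const]
    rw [← mul_div_assoc, ← mul_assoc, ← pow_succ', Finset.filter_ne',
      Finset.card_erase_add_one (Finset.mem_univ i)]
    simp
  have h3 : ∏ j with j ≠ i, (t i - t j) ≠ 0 := Finset.prod_ne_zero_iff.mpr fun j hj =>
    sub_ne_zero.mpr fun e => (Finset.mem_filter.mp hj).2 (ht e).symm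
  have h4 : ∏ j, s j ≠ 0 := Finset.prod_ne_zero_iff.mpr fun j _ => hs0 j
  have h5 : ∏ j with j ≠ i, t j ≠ 0 := Finset.prod_ne_zero_iff.mpr fun j _ => ht0 j
  have hti := ht0 i
  have h7 : (-(t i)⁻¹) ≠ 0 := neg_ne_zero.mpr (inv_ne_zero hti)
  have h6 : (-(t i)⁻¹) ^ n ≠ 0 := pow_ne_zero _ h7
  have h2' : ∏ j with j ≠ i, ((t i)⁻¹ - (t j)⁻¹) = (-(t i)⁻¹) ^ n *
      (∏ j with j ≠ i, (t i - t j)) / (∏ j with j ≠ i, t j) / (-(t i)⁻¹) := by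
    rw [← h2]; field_simp
  rw [h1, h2', eigenWeight, ← prod_ne_mul i t]
  generalize (-(t i)⁻¹) ^ n = Z at *
  field_simp

end

end QToda

/-! ### Scalar recursions for the branching coefficients -/

namespace QToda

noncomputable section

variable {K : Type*} [Field K] {n : ℕ} {q : K} {s : Fin n → K}

/-- The family `θ ↦ f (θ - e_i)`, extended by zero. -/
def lower (i : Fin n) (f : (Fin n → ℕ) → K) (θ : Fin n → ℕ) : K :=
  if θ i = 0 then 0 else f (θ - Pi.single i 1)

theorem lower_eq_of_step {i : Fin n} {f : (Fin n → ℕ) → K} {θ : Fin n → ℕ} {x : K}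
    (h0 : θ i = 0 → x = 0) (h : ∀ η, θ = η + Pi.single i 1 → f η = x) : lower i f θ = x := by
  unfold lower
  split_ifs with hi
  · exact (h0 hi).symm
  · apply h
    ext j
    by_cases hj : j = i
    · subst hj; simp; omega
    · simp [hj]

theorem shiftBy_eq_self_of_eq_zero {θ : Fin n → ℕ} {i : Fin n} (h : θ i = 0) :
    shiftBy q θ s i = s i := by
  simp [shiftBy, h]

theorem shiftBy_eq_mul_shiftBy_add_single (hq : q ≠ 0) (θ : Fin n → ℕ) (i : Fin n) :
    shiftBy q θ s i = q * shiftBy q (θ + Pi.single i 1) s i := by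
  simp only [shiftBy]
  rw [add_single_self, Nat.cast_add, neg_add, zpow_add₀ hq, Nat.cast_one, zpow_neg_one]
  field_simp

theorem prod_div_prod_shiftBy (hs : IsGeneric q s) (θ : Fin n → ℕ) :
    (∏ i, s i) / ∏ i, shiftBy q θ s i = q ^ ∑ i, θ i := by
  rw [← Finset.prod_div_distrib, ← Finset.prod_pow_eq_pow_sum]
  refine Finset.prod_congr rfl fun i _ => ?_
  have h1 := hs.ne_zero i
  have h2 := pow_ne_zero (θ i) hs.q_ne_zero
  simp only [shiftBy, zpow_neg, zpow_natCast]
  field_simp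

/-- For `θ_i = 0` there is no predecessor `θ - e_i`. The weight vanishes there because `t_i = s_i`,
so the Lagrange sum may still run over all `i`. -/
theorem pieriWeight_eq_zero {s : Fin (n + 1) → K} (hs : IsGeneric q s) {θ : Fin n → ℕ} {i : Fin n}
    (h : θ i = 0) :
    pieriWeight s (shiftBy q θ fun i => s i.castSucc) i.castSucc = 0 := by
  rw [pieriWeight, Finset.prod_eq_zero (Finset.mem_univ i), zero_div]
  rw [shiftBy_eq_self_of_eq_zero h, div_self (hs.ne_zero _), sub_self]

theorem eigenWeight_eq_zero {θ : Fin n → ℕ} {i : Fin n} (h : θ i = 0) :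
    eigenWeight s (shiftBy q θ s) i = 0 := by
  rw [eigenWeight, Finset.prod_eq_zero (Finset.mem_univ i), zero_div]
  rw [shiftBy_eq_self_of_eq_zero h, sub_self]

theorem lower_branchCoeffA_shiftBy {s : Fin (n + 1) → K} (hs : IsGeneric q s) (c : K)
    (θ : Fin n → ℕ) (i : Fin n) :
    lower i (fun η => c * pieriCoeff q s i.castSucc *
        branchCoeffA q (shiftBy q (Pi.single i.castSucc 1) s) η) θ =
      branchCoeffA q s θ *
        (c * pieriWeight s (shiftBy q θ fun i => s i.castSucc) i.castSucc) := by
  refine lower_eq_of_step (fun h => ?_) (fun η h => ?_)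
  · rw [pieriWeight_eq_zero hs h, mul_zero, mul_zero]
  · have := branchCoeffA_shiftBy_single_mul_pieriCoeff hs η i _ rfl
    rw [← h] at this
    linear_combination c * this

theorem branchCoeffA_pieri {s : Fin (n + 1) → K} (hs : IsGeneric q s) (θ : Fin n → ℕ) :
    branchCoeffA q (shiftBy q (Pi.single (Fin.last n) 1) s) θ +
      ∑ i : Fin n, lower i (fun η => 1 * pieriCoeff q s i.castSucc *
        branchCoeffA q (shiftBy q (Pi.single i.castSucc 1) s) η) θ = branchCoeffA q s θ := by
  simp only [lower_branchCoeffA_shiftBy hs, branchCoeffA_shiftBy_single_last hs θ _ rfl]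
  simp only [one_mul]
  rw [← Finset.mul_sum, ← mul_add, add_comm, ← Fin.sum_univ_castSucc,
    sum_pieriWeight hs.injective hs.ne_zero, mul_one]

theorem branchCoeffA_pieri_mul {s : Fin (n + 1) → K} (hs : IsGeneric q s) (θ : Fin n → ℕ) :
    s (Fin.last n) * branchCoeffA q (shiftBy q (Pi.single (Fin.last n) 1) s) θ +
      ∑ i : Fin n, lower i (fun η => s i.castSucc * pieriCoeff q s i.castSucc *
        branchCoeffA q (shiftBy q (Pi.single i.castSucc 1) s) η) θ =
      branchCoeffA q s θ * (s (Fin.last n) * q ^ ∑ i, θ i) := by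
  simp only [lower_branchCoeffA_shiftBy hs, branchCoeffA_shiftBy_single_last hs θ _ rfl]
  rw [← Finset.mul_sum, ← prod_div_prod_shiftBy hs.castSucc]
  have := sum_mul_pieriWeight hs.injective hs.ne_zero (hs.castSucc.shiftBy θ).ne_zero
  rw [Fin.sum_univ_castSucc, Fin.prod_univ_castSucc] at this
  linear_combination branchCoeffA q s θ * this

/-- With `Q = q^{∑ θ_i}` and `s_n` the last parameter, interpolation evaluates the lowered sum,
relative to `branchCoeffA q s θ`, as `∑ t_i - ∑_{i<n} s_i - s_n (1 - Q)`. Subtracting it from the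
diagonal leaves the sum of all `s_i`. -/
theorem branchCoeffA_eigen {s : Fin (n + 1) → K} (hs : IsGeneric q s) (θ : Fin n → ℕ) :
    branchCoeffA q s θ * (∑ i, shiftBy q θ (fun i : Fin n => s i.castSucc) i +
        s (Fin.last n) * q ^ ∑ i, θ i) -
      ∑ i : Fin n, lower i (fun η => branchCoeffA q s η *
        (pieriCoeff q (shiftBy q η fun i => s i.castSucc) i *
          shiftBy q η (fun i => s i.castSucc) i)) θ =
      (∑ i, s i) * branchCoeffA q s θ := by
  set t := shiftBy q θ (fun i : Fin n => s i.castSucc) with ht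
  have hq := hs.q_ne_zero
  have ht0 : ∀ i, t i ≠ 0 := (hs.castSucc.shiftBy θ).ne_zero
  have h : ∀ i : Fin n, lower i (fun η => branchCoeffA q s η *
        (pieriCoeff q (shiftBy q η fun i => s i.castSucc) i *
          shiftBy q η (fun i => s i.castSucc) i)) θ =
      branchCoeffA q s θ * (t i * eigenWeight (fun i => s i.castSucc) t i -
        s (Fin.last n) * eigenWeight (fun i => s i.castSucc) t i) := fun i => by
    refine lower_eq_of_step (fun h => ?_) (fun η h => ?_)
    · rw [ht, eigenWeight_eq_zero h]; ring
    · have h1 := branchCoeffA_mul_pieriCoeff_shiftBy hs η i _ rfl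
      have h2 := shiftBy_eq_mul_shiftBy_add_single (s := fun i : Fin n => s i.castSucc) hq η i
      rw [← h, ← ht] at h1 h2
      rw [h2, ← mul_assoc, h1]
      have := ht0 i
      field_simp
  have hinj := (hs.castSucc.shiftBy θ).injective
  simp only [h]
  rw [← Finset.mul_sum, Finset.sum_sub_distrib, ← Finset.mul_sum, sum_eigenWeight hinj ht0,
    sum_mul_eigenWeight hinj ht0, ht, prod_div_prod_shiftBy hs.castSucc, Fin.sum_univ_castSucc]
  ring

theorem branchCoeffA_eigen_inv {s : Fin (n + 1) → K} (hs : IsGeneric q s) (θ : Fin n → ℕ) :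
    branchCoeffA q s θ * (∑ i, (shiftBy q θ (fun i : Fin n => s i.castSucc) i)⁻¹ +
        (s (Fin.last n))⁻¹ * (q ^ ∑ i, θ i)⁻¹) -
      ∑ i : Fin n, lower i (fun η => branchCoeffA q s η *
        ((s (Fin.last n))⁻¹ * (q ^ ∑ i, η i)⁻¹ *
          pieriCoeff q (shiftBy q η fun i => s i.castSucc) i)) θ =
      (∑ i, (s i)⁻¹) * branchCoeffA q s θ := by
  set t := shiftBy q θ (fun i : Fin n => s i.castSucc) with ht
  have hq := hs.q_ne_zero
  have ht0 : ∀ i, t i ≠ 0 := (hs.castSucc.shiftBy θ).ne_zero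
  have hQ : q ^ (∑ i, θ i) ≠ 0 := pow_ne_zero _ hq
  have hsn := hs.ne_zero (Fin.last n)
  have h : ∀ i : Fin n, lower i (fun η => branchCoeffA q s η *
        ((s (Fin.last n))⁻¹ * (q ^ ∑ i, η i)⁻¹ *
          pieriCoeff q (shiftBy q η fun i => s i.castSucc) i)) θ =
      branchCoeffA q s θ * ((s (Fin.last n))⁻¹ * (q ^ ∑ i, θ i)⁻¹ *
        (eigenWeight (fun i => s i.castSucc) t i -
        s (Fin.last n) * (eigenWeight (fun i => s i.castSucc) t i / t i))) := fun i => by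
    refine lower_eq_of_step (fun h => ?_) (fun η h => ?_)
    · rw [ht, eigenWeight_eq_zero h]; ring
    · have h1 := branchCoeffA_mul_pieriCoeff_shiftBy hs η i _ rfl
      have h3 : q ^ ∑ i, θ i = q ^ (∑ i, η i) * q := by
        rw [h, ← pow_succ]; simp [Finset.sum_add_distrib]
      rw [← h, ← ht] at h1
      have hQ' : q ^ (∑ i, η i) ≠ 0 := pow_ne_zero _ hq
      rw [h3, mul_left_comm, h1]
      have := ht0 i
      field_simp
  have hinj := (hs.castSucc.shiftBy θ).injective
  simp only [h]
  rw [← Finset.mul_sum, ← Finset.mul_sum, Finset.sum_sub_distrib, ← Finset.mul_sum,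
    sum_eigenWeight hinj ht0, sum_eigenWeight_div hinj hs.castSucc.ne_zero ht0, ht,
    prod_div_prod_shiftBy hs.castSucc, Fin.sum_univ_castSucc]
  field_simp
  ring

/-! ### The B-type coefficients -/

/-- The single-index factor of the `B`-type branching coefficient. -/
def singleCoeffB (q a : K) (m : ℕ) : K :=
  q ^ m / (qPoch q q m * qPoch (q / a ^ 2) q m)

/-- The additional pair factor of the `B`-type branching coefficient. -/
def pairCoeffB (q a b : K) (m k : ℕ) : K :=
  qPoch (q / (a * b)) q (m + k) / (qPoch (q / (a * b)) q m * qPoch (q / (a * b)) q k)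

theorem pairCoeffB_comm (q a b : K) (m k : ℕ) : pairCoeffB q a b m k = pairCoeffB q b a k m := by
  rw [pairCoeffB, pairCoeffB, mul_comm a b, add_comm, mul_comm (qPoch _ _ m)]

/-- This supplies the factor `(t_i - s_j⁻¹)/(t_i - t_j⁻¹)`, the reflection of the type A one. Since
`pairCoeffB` is symmetric, one step covers both positions of `i` in the pair. -/
theorem pairCoeffB_step {q a b : K} (hq : q ≠ 0) (ha : a ≠ 0) (hb : b ≠ 0)
    (h : ∀ k : ℕ, a * b ≠ q ^ k) (m k : ℕ) :
    pairCoeffB q a b m k = pairCoeffB q a b (m + 1) k *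
      ((q ^ (-((m + 1 : ℕ) : ℤ)) * a - b⁻¹) /
        (q ^ (-((m + 1 : ℕ) : ℤ)) * a - (q ^ (-(k : ℤ)) * b)⁻¹)) := by
  have n1 := sub_ne_zero.mpr (h (m + 1))
  have n2 := sub_ne_zero.mpr (h (m + k + 1))
  simp only [pairCoeffB, zpow_neg, zpow_natCast, add_right_comm m 1 k, qPoch_succ]
  simp only [pow_succ, pow_add] at n1 n2 ⊢
  have hQ : q ^ m ≠ 0 := pow_ne_zero _ hq
  have hR : q ^ k ≠ 0 := pow_ne_zero _ hq
  have f1 : (q ^ m * q)⁻¹ * a - b⁻¹ = (a * b - q ^ m * q) / (q ^ m * q * b) := by field_simp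
  have f2 : (q ^ m * q)⁻¹ * a - ((q ^ k)⁻¹ * b)⁻¹ =
      (a * b - q ^ m * q ^ k * q) / (q ^ m * q * b) := by field_simp
  have f3 : 1 - q ^ m * (q / (a * b)) = (a * b - q ^ m * q) / (a * b) := by field_simp
  have f4 : 1 - q ^ m * q ^ k * (q / (a * b)) = (a * b - q ^ m * q ^ k * q) / (a * b) := by
    field_simp
  rw [f1, f2, f3, f4]
  generalize a * b - q ^ m * q = X at *
  generalize a * b - q ^ m * q ^ k * q = Y at *
  generalize qPoch (q / (a * b)) q m = U
  generalize qPoch (q / (a * b)) q k = V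
  by_cases hU : U = 0
  · simp [hU]
  by_cases hV : V = 0
  · simp [hV]
  field_simp

theorem singleCoeffB_step {q a : K} (hq : q ≠ 0) (hq' : ∀ k : ℕ, 0 < k → q ^ k ≠ 1) (ha : a ≠ 0)
    (h : ∀ k : ℕ, a * a ≠ q ^ k) (m : ℕ) :
    singleCoeffB q a m = singleCoeffB q a (m + 1) *
      (q⁻¹ * ((1 - a / (q ^ (-((m + 1 : ℕ) : ℤ)) * a)) *
        (1 - a⁻¹ / (q ^ (-((m + 1 : ℕ) : ℤ)) * a)))) := by
  simp only [singleCoeffB, zpow_neg, zpow_natCast, qPoch_succ, pow_succ]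
  have hQ : q ^ m ≠ 0 := pow_ne_zero _ hq
  have n1 := sub_ne_zero.mpr (hq' (m + 1) (by omega)).symm
  have n2 := sub_ne_zero.mpr (h (m + 1))
  simp only [pow_succ, pow_zero, one_mul] at n1 n2 ⊢
  have f1 : 1 - a / ((q ^ m * q)⁻¹ * a) = 1 - q ^ m * q := by field_simp
  have f2 : 1 - a⁻¹ / ((q ^ m * q)⁻¹ * a) = (a * a - q ^ m * q) / (a * a) := by field_simp
  have f3 : 1 - q ^ m * (q / (a * a)) = (a * a - q ^ m * q) / (a * a) := by field_simp
  rw [f1, f2, f3]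
  generalize 1 - q ^ m * q = X at *
  generalize a * a - q ^ m * q = Y at *
  generalize qPoch q q m = U
  generalize qPoch (q / (a * a)) q m = V
  by_cases hU : U = 0
  · simp [hU]
  by_cases hV : V = 0
  · simp [hV]
  field_simp

/-- The power `q^{(n-k)θ_k}` is distributed as one `q^{θ_k}` for the index `k` and one for each of
the `n - 1 - k` pairs `(k, j)` with `j > k`. -/
theorem eCoeff_eq (q : K) (s : Fin n → K) (θ : Fin n → ℕ) :
    eCoeff q s θ = (∏ k, singleCoeffB q (s k) (θ k)) *
      ∏ i, ∏ j with i < j, pairCoeff q (s i) (s j) (θ i) (θ j) *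
        pairCoeffB q (s i) (s j) (θ i) (θ j) := by
  have hc : ∀ k : Fin n, (Finset.univ.filter fun j => k < j).card + 1 = n - k := fun k => by
    rw [Finset.filter_lt_eq_Ioi, Fin.card_Ioi]
    omega
  have h1 : ∀ k : Fin n, q ^ ((n - (k : ℕ)) * θ k) = q ^ θ k * ∏ j with k < j, q ^ θ k := by
    intro k
    rw [Finset.prod_const, ← pow_succ', hc, ← pow_mul, mul_comm]
  have h2 : ∀ k : Fin n, q ^ ((n - (k : ℕ)) * θ k) /
      (qPoch q q (θ k) * qPoch (q / s k ^ 2) q (θ k)) =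
        singleCoeffB q (s k) (θ k) * ∏ j with k < j, q ^ θ k := fun k => by
    rw [h1, singleCoeffB, mul_div_right_comm]
  rw [eCoeff, Finset.prod_congr rfl fun k _ => h2 k, Finset.prod_mul_distrib, mul_assoc,
    ← Finset.prod_mul_distrib]
  congr 1
  refine Finset.prod_congr rfl fun i _ => ?_
  rw [← Finset.prod_mul_distrib]
  refine Finset.prod_congr rfl fun j _ => ?_
  rw [pairCoeff, pairCoeffB]
  ring

/-- The parameters are generic for the root system `B_n`: in addition no product of two of them
is a power of `q`. -/
structure IsGenericB (q : K) (s : Fin n → K) : Prop extends IsGeneric q s where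
  mul_ne : ∀ i j, ∀ k : ℕ, s i * s j ≠ q ^ k

/-- The weights in the Lagrange interpolation formula in the variables `t + t⁻¹`. -/
def eigenWeightB (s t : Fin n → K) (i : Fin n) : K :=
  (∏ j, ((t i + (t i)⁻¹) - (s j + (s j)⁻¹))) /
    ∏ j with j ≠ i, ((t i + (t i)⁻¹) - (t j + (t j)⁻¹))

theorem eCoeff_mul_pieriCoeff_shiftBy (hs : IsGenericB q s) (θ : Fin n → ℕ) (i : Fin n)
    (t : Fin n → K) (ht : t = shiftBy q (θ + Pi.single i 1) s) :
    eCoeff q s θ * pieriCoeff q (shiftBy q θ s) i * (q * t i) =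
      eCoeff q s (θ + Pi.single i 1) * eigenWeightB s t i := by
  have hq := hs.q_ne_zero
  have ht0 : ∀ j, t j ≠ 0 := by rw [ht]; exact (hs.shiftBy _).ne_zero
  have h1 : (∏ i, ∏ j with i < j, pairCoeff q (s i) (s j) (θ i) (θ j) *
        pairCoeffB q (s i) (s j) (θ i) (θ j)) * pieriCoeff q (shiftBy q θ s) i =
      (∏ a, ∏ b with a < b, pairCoeff q (s a) (s b) ((θ + Pi.single i 1 : Fin n → ℕ) a)
          ((θ + Pi.single i 1 : Fin n → ℕ) b) *
        pairCoeffB q (s a) (s b) ((θ + Pi.single i 1 : Fin n → ℕ) a)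
          ((θ + Pi.single i 1 : Fin n → ℕ) b)) *
        ∏ j with j ≠ i, ((t i - s j) / (t i - t j) * ((t i - (s j)⁻¹) / (t i - (t j)⁻¹))) := by
    refine prod_pairs_mul_eq i ?_ ?_ ?_
    · intro a b ha hb
      rw [add_single_of_ne θ ha, add_single_of_ne θ hb]
    · intro b hb
      have e1 := pairCoeff_left_step hq (hs.ne_zero _) (hs.ne_zero _)
        (hs.ratio _ _ hb.ne) (θ i) (θ b)
      have e2 := pairCoeffB_step hq (hs.ne_zero i) (hs.ne_zero b) (hs.mul_ne i b) (θ i) (θ b)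
      rw [ht]
      simp only [shiftBy]
      rw [add_single_self, add_single_of_ne θ hb.ne', mul_right_comm, e1, e2]
      ring
    · intro a ha
      have e1 := pairCoeff_right_step hq (hs.ne_zero _) (hs.ne_zero _)
        (hs.ratio _ _ ha.ne) (θ a) (θ i)
      have e2 := pairCoeffB_step hq (hs.ne_zero i) (hs.ne_zero a) (hs.mul_ne i a) (θ i) (θ a)
      rw [pairCoeffB_comm, pairCoeffB_comm q _ _ (_ + 1)] at e2
      rw [ht]
      simp only [shiftBy]
      rw [add_single_self, add_single_of_ne θ ha.ne, e1, e2]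
      ring
  have h2 : (∏ j, singleCoeffB q (s j) (θ j)) * 1 =
      (∏ j, singleCoeffB q (s j) ((θ + Pi.single i 1 : Fin n → ℕ) j)) *
        (q⁻¹ * ((1 - s i / t i) * (1 - (s i)⁻¹ / t i))) := by
    refine prod_eq_of_eq_off i (fun j hj => by rw [add_single_of_ne θ hj]) ?_
    rw [ht, mul_one]
    simp only [shiftBy]
    rw [add_single_self]
    exact singleCoeffB_step hq hs.q_pow_ne (hs.ne_zero _) (hs.mul_ne i i) _
  have h3 : eigenWeightB s t i = t i * ((1 - s i / t i) * (1 - (s i)⁻¹ / t i)) *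
      ∏ j with j ≠ i, ((t i - s j) / (t i - t j) * ((t i - (s j)⁻¹) / (t i - (t j)⁻¹))) := by
    have hti := ht0 i
    rw [eigenWeightB, ← prod_ne_mul i, mul_div_assoc, ← Finset.prod_div_distrib]
    congr 1
    · have := hs.ne_zero i
      field_simp
      ring
    · refine Finset.prod_congr rfl fun j _ => ?_
      -- The factors for `x` and `x⁻¹` combine to a difference in the variable `t + t⁻¹`.
      have e1 : ∀ x : K, x ≠ 0 →
          (t i + (t i)⁻¹) - (x + x⁻¹) = (t i - x) * (t i - x⁻¹) / t i := fun x hx => by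
        field_simp
        ring
      rw [e1 _ (hs.ne_zero j), e1 _ (ht0 j), div_div_div_cancel_right₀ hti, mul_div_mul_comm]
  rw [eCoeff_eq, eCoeff_eq, h3]
  rw [mul_one] at h2
  rw [mul_assoc (∏ k, singleCoeffB q (s k) (θ k)), h1, h2]
  field_simp

/-- The equality `u + u⁻¹ = v + v⁻¹` forces `u = v` or `uv = 1`; the latter would make some `s_i
s_j` a power of `q`. -/
theorem IsGenericB.shiftBy_add_inv_injective (hs : IsGenericB q s) (θ : Fin n → ℕ) :
    Function.Injective fun i => shiftBy q θ s i + (shiftBy q θ s i)⁻¹ := by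
  intro i j e
  have h0 := (hs.shiftBy θ).ne_zero
  have hi := h0 i
  have hj := h0 j
  have h : (shiftBy q θ s i - shiftBy q θ s j) * (shiftBy q θ s i * shiftBy q θ s j - 1) = 0 := by
    simp only at e
    field_simp at e
    linear_combination e
  rcases mul_eq_zero.mp h with h | h
  · exact (hs.shiftBy θ).injective (sub_eq_zero.mp h)
  · exfalso
    apply hs.mul_ne i j (θ i + θ j)
    have h1 : q ^ θ i ≠ 0 := pow_ne_zero _ hs.q_ne_zero
    have h2 : q ^ θ j ≠ 0 := pow_ne_zero _ hs.q_ne_zero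
    simp only [shiftBy, zpow_neg, zpow_natCast, sub_eq_zero] at h
    field_simp at h
    rw [h, pow_add]

/-- The lowered sum is the interpolation at the nodes `t_i + t_i⁻¹` of the polynomial with roots
`s_i + s_i⁻¹`, hence equals the difference of the sums of nodes and of roots, times `eCoeff q s θ`.
-/
theorem eCoeff_eigen (hs : IsGenericB q s) (θ : Fin n → ℕ) :
    eCoeff q s θ * (∑ i, shiftBy q θ s i + ∑ i, (shiftBy q θ s i)⁻¹) -
      ∑ i : Fin n, lower i (fun η => eCoeff q s η *
        (pieriCoeff q (shiftBy q η s) i * shiftBy q η s i)) θ =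
      (∑ i, (s i + (s i)⁻¹)) * eCoeff q s θ := by
  have h : ∀ i : Fin n, lower i (fun η => eCoeff q s η *
        (pieriCoeff q (shiftBy q η s) i * shiftBy q η s i)) θ =
      eCoeff q s θ * eigenWeightB s (shiftBy q θ s) i := fun i => by
    refine lower_eq_of_step (fun h => ?_) (fun η h => ?_)
    · rw [eigenWeightB, Finset.prod_eq_zero (Finset.mem_univ i), zero_div, mul_zero]
      rw [shiftBy_eq_self_of_eq_zero h, sub_self]
    · have h1 := eCoeff_mul_pieriCoeff_shiftBy hs η i _ rfl
      rw [shiftBy_eq_mul_shiftBy_add_single hs.q_ne_zero η i, ← mul_assoc, h1, ← h]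
  simp only [h]
  have := sum_prod_sub_div_prod_sub_eq_sum_sub _ (hs.shiftBy_add_inv_injective θ)
    fun i => s i + (s i)⁻¹
  rw [← Finset.mul_sum]
  simp only [eigenWeightB]
  rw [this]
  simp only [Finset.sum_add_distrib]
  ring

end

end QToda

/-! ### Locally finite sums, shifts and monomials -/

namespace QToda

noncomputable section

open scoped MvPowerSeries.WithPiTopology

variable {N : ℕ} {K : Type*} [Field K]

theorem add_single_injective {n : ℕ} (i : Fin n) :
    Function.Injective fun θ : Fin n → ℕ => θ + Pi.single i 1 := fun _ _ h => add_right_cancel h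

theorem lower_add_single {n : ℕ} (i : Fin n) (c : (Fin n → ℕ) → K) (θ : Fin n → ℕ) :
    lower i c (θ + Pi.single i 1) = c θ := by
  simp [lower]

section Summation

variable [TopologicalSpace K]

/-- The coefficient at `m` only sees indices with `e i k ≤ m (v k)` for all `k`, and injectivity of
`e` leaves finitely many of them. -/
theorem summable_of_X_pow_dvd {ι κ : Type*} [Finite κ] {e : ι → κ → ℕ}
    (he : Function.Injective e) (v : κ → Fin N) {g : ι → LambdaB N K}
    (h : ∀ i k, (MvPowerSeries.X (v k) : LambdaB N K) ^ e i k ∣ g i) : Summable g := by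
  have := Fintype.ofFinite κ
  rw [MvPowerSeries.WithPiTopology.summable_iff_summable_coeff]
  intro m
  apply summable_of_hasFiniteSupport
  classical
  refine Set.Finite.subset ((Set.finite_Iic fun k => m (v k)).preimage he.injOn) ?_
  intro i hi k
  by_contra hlt
  exact hi (MvPowerSeries.X_pow_dvd_iff.mp (h i k) m (not_le.mp hlt))

theorem hasSum_lower_iff {n : ℕ} (i : Fin n) {c : (Fin n → ℕ) → K} {g : (Fin n → ℕ) → LambdaB N K}
    {f : LambdaB N K} :
    HasSum (fun θ => lower i c θ • g θ) f ↔
      HasSum (fun θ => c θ • g (θ + Pi.single i 1)) f := by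
  rw [← (add_single_injective i).hasSum_iff]
  · simp only [Function.comp_def, lower_add_single]
  · intro θ hθ
    have : θ i = 0 := by
      by_contra h0
      apply hθ
      refine ⟨θ - Pi.single i 1, ?_⟩
      ext j
      by_cases hj : j = i
      · subst hj; simp; omega
      · simp [hj]
    simp [lower, this]

variable [DiscreteTopology K]

theorem hasFormalSum_of_hasSum {ι σ : Type*} {g : ι → MvPowerSeries σ K} {f : MvPowerSeries σ K}
    (h : HasSum g f) : HasFormalSum g f := by
  intro m
  have hm := (MvPowerSeries.WithPiTopology.hasSum_iff_hasSum_coeff.mp h) m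
  have hfin := hm.summable.hasFiniteSupport_of_discreteTopology
  exact ⟨hfin, by rw [← tsum_eq_finsum (L := .unconditional ι) hfin, hm.tsum_eq]⟩

theorem eq_formalSum_of_hasSum {ι σ : Type*} {g : ι → MvPowerSeries σ K} {f : MvPowerSeries σ K}
    (h : HasSum g f) : f = formalSum g := by
  ext m
  exact (hasFormalSum_of_hasSum h m).2.symm

theorem hasSum_formalSum {ι σ : Type*} {g : ι → MvPowerSeries σ K} (h : Summable g) :
    HasSum g (formalSum g) := by
  obtain ⟨f, hf⟩ := h
  rwa [← eq_formalSum_of_hasSum hf]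

/-- A linear operator which acts on a family of power series by a diagonal and a raising part has
a combination of the family as eigenvector as soon as the coefficients satisfy the corresponding
recursion. -/
theorem eigen_of_recursion {n : ℕ} {g : (Fin n → ℕ) → LambdaB N K}
    (hg : ∀ c : (Fin n → ℕ) → K, Summable fun θ => c θ • g θ) {c : (Fin n → ℕ) → K}
    {f : LambdaB N K} (hf : HasSum (fun θ => c θ • g θ) f) (L : LambdaB N K →ₗ[K] LambdaB N K)
    (hL : Continuous L) {d : (Fin n → ℕ) → K} {a : Fin n → (Fin n → ℕ) → K}
    (h : ∀ θ, L (g θ) = d θ • g θ - ∑ i, a i θ • g (θ + Pi.single i 1)) {μ : K}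
    (hc : ∀ θ, c θ * d θ - ∑ i, lower i (fun η => c η * a i η) θ = μ * c θ) :
    L f = μ • f := by
  obtain ⟨A, hA⟩ := hg fun θ => c θ * d θ
  have hB : ∀ i, ∃ B, HasSum (fun θ => (c θ * a i θ) • g (θ + Pi.single i 1)) B := fun i => by
    obtain ⟨B, hB⟩ := hg (lower i fun θ => c θ * a i θ)
    exact ⟨B, (hasSum_lower_iff i).mp hB⟩
  choose B hB using hB
  have h1 : HasSum (fun θ => L (c θ • g θ)) (L f) := hf.map L hL
  have h2 : HasSum (fun θ => L (c θ • g θ)) (A - ∑ i, B i) := by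
    refine (hA.sub (hasSum_sum fun i _ => hB i)).congr_fun ?_
    intro θ
    simp only [map_smul, h, smul_sub, Finset.smul_sum, smul_smul]
  -- The same value is obtained by reindexing each `B i` by its target vector; the total coefficient
  -- of `g θ` is then the left-hand side of `hc`.
  have h3 : HasSum (fun θ => μ • c θ • g θ) (A - ∑ i, B i) := by
    refine (hA.sub (hasSum_sum fun i _ => (hasSum_lower_iff i).mpr (hB i))).congr_fun ?_
    intro θ
    rw [smul_smul, ← hc, sub_smul, Finset.sum_smul]
  rw [h1.unique h2, ← h3.unique (hf.const_smul μ)]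

end Summation

/-- The ring homomorphism substituting `q x_i` for `x_i`. -/
def shiftHom (N : ℕ) (q : K) (i : ℕ) : LambdaB N K →+* LambdaB N K :=
  MvPowerSeries.rescale fun k : Fin N =>
    (if (k : ℕ) + 1 = i then q else 1) * (if (k : ℕ) = i then q⁻¹ else 1)

theorem shiftHom_smul (q : K) (i : ℕ) (c : K) (f : LambdaB N K) :
    shiftHom N q i (c • f) = c • shiftHom N q i f := by
  ext m
  simp only [shiftHom, MvPowerSeries.coeff_rescale, map_smul, smul_eq_mul]
  ring

/-- The operator substituting `q x_i` for `x_i`, as a linear map. -/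
def shiftLinear (N : ℕ) (q : K) (i : ℕ) : LambdaB N K →ₗ[K] LambdaB N K where
  toFun := shiftHom N q i
  map_add' := map_add _
  map_smul' := shiftHom_smul q i

theorem continuous_shiftHom [TopologicalSpace K] [DiscreteTopology K] (q : K) (i : ℕ) :
    Continuous (shiftHom N q i) := by
  refine continuous_pi fun m => ?_
  exact (continuous_const (y := (m.prod fun k e =>
    ((if (k : ℕ) + 1 = i then q else 1) * (if (k : ℕ) = i then q⁻¹ else 1)) ^ e))).mul
      (MvPowerSeries.WithPiTopology.continuous_coeff K m)

/-- The variable `x_i` occurs only in `y_{i-1}` and, inverted, in `y_i`. The shift is therefore a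
rescaling of these two, which makes it multiplicative. -/
theorem qShift_eq_shiftHom {q : K} (hq : q ≠ 0) (i : Fin N) (f : LambdaB N K) :
    qShift q i f = shiftHom N q i f := by
  ext m
  rw [shiftHom, MvPowerSeries.coeff_rescale, Finsupp.prod_fintype _ _ (fun _ => pow_zero _)]
  change q ^ xExponent m i * _ = _
  congr 1
  simp only [mul_pow, Finset.prod_mul_distrib, ite_pow, one_pow]
  rw [← Finset.prod_filter, ← Finset.prod_filter, Finset.prod_pow_eq_pow_sum,
    Finset.prod_pow_eq_pow_sum, xExponent, zpow_sub₀ hq, zpow_natCast, ← Nat.cast_sum,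
    zpow_natCast, inv_pow, div_eq_mul_inv]
  congr 3
  simp [Fin.val_inj, Finset.sum_filter]

theorem prod_filter_ite_val (a b j : ℕ) (x : K) :
    ∏ k ∈ Finset.univ.filter (fun k : Fin N => a ≤ (k : ℕ) ∧ (k : ℕ) < b), (if (k : ℕ) = j then x else 1) =
      if a ≤ j ∧ j < b ∧ j < N then x else 1 := by
  by_cases hj : j < N
  · have : ∀ k : Fin N, ((k : ℕ) = j) ↔ k = ⟨j, hj⟩ := fun k => by simp [Fin.ext_iff]
    simp only [this, Finset.prod_ite_eq', Finset.mem_filter, Finset.mem_univ, true_and, hj,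
      and_true]
  · rw [if_neg (by tauto)]
    exact Finset.prod_eq_one fun k _ => if_neg (by have := k.2; omega)

theorem shiftHom_X (q : K) (i : ℕ) (k : Fin N) :
    shiftHom N q i (MvPowerSeries.X k) =
      ((if (k : ℕ) + 1 = i then q else 1) * (if (k : ℕ) = i then q⁻¹ else 1)) •
        MvPowerSeries.X k := by
  ext m
  rw [shiftHom, MvPowerSeries.coeff_rescale, map_smul, MvPowerSeries.coeff_X, smul_eq_mul]
  split_ifs with h
  all_goals simp_all [Finsupp.prod_single_index]

theorem shiftHom_xRatio (q : K) (i a b : ℕ) :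
    shiftHom N q i (xRatio N K a b) =
      ((if 0 < i ∧ a < i ∧ i ≤ b ∧ i ≤ N then q else 1) *
        (if a ≤ i ∧ i < b ∧ i < N then q⁻¹ else 1)) • xRatio N K a b := by
  rw [xRatio, map_prod]
  simp only [shiftHom_X, Finset.prod_smul, Finset.prod_mul_distrib, prod_filter_ite_val]
  congr 2
  cases i with
  | zero => simp
  | succ i =>
    simp only [Nat.add_right_cancel_iff, prod_filter_ite_val]
    congr 1
    simp

theorem xRatio_mul_xRatio {a b c : ℕ} (hab : a ≤ b) (hbc : b ≤ c) :
    xRatio N K a b * xRatio N K b c = xRatio N K a c := by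
  rw [xRatio, xRatio, xRatio, ← Finset.prod_union]
  · refine Finset.prod_congr ?_ fun _ _ => rfl
    ext k
    simp only [Finset.mem_union, Finset.mem_filter, Finset.mem_univ, true_and]
    omega
  · rw [Finset.disjoint_filter]
    intro k _ h1 h2
    omega

theorem X_dvd_xRatio {a b : ℕ} (ha : a < N) (hab : a < b) :
    (MvPowerSeries.X ⟨a, ha⟩ : LambdaB N K) ∣ xRatio N K a b :=
  Finset.dvd_prod_of_mem _ (Finset.mem_filter.mpr ⟨Finset.mem_univ _, le_refl _, hab⟩)

theorem xRatio_succ (i : Fin N) : xRatio N K i (i + 1) = MvPowerSeries.X i := by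
  rw [xRatio]
  have : (Finset.univ.filter fun k : Fin N => (i : ℕ) ≤ k ∧ (k : ℕ) < i + 1) = {i} := by
    ext k
    simp only [Finset.mem_filter, Finset.mem_univ, true_and, Finset.mem_singleton, Fin.ext_iff]
    omega
  rw [this, Finset.prod_singleton]

/-- The monomial `∏ (x_n / x_i) ^ θ_i`. -/
def xMono (N : ℕ) (K : Type*) [Field K] {n : ℕ} (θ : Fin n → ℕ) : LambdaB N K :=
  ∏ i : Fin n, xRatio N K i n ^ θ i

variable {n : ℕ}

theorem xRatio_mul_xMono (θ : Fin n → ℕ) (i : Fin n) :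
    xRatio N K i n * xMono N K θ = xMono N K (θ + Pi.single i 1) := by
  simp only [xMono, Pi.add_apply, pow_add, Finset.prod_mul_distrib]
  rw [mul_comm]
  congr 1
  rw [Finset.prod_eq_single i]
  · simp
  · intro j _ hj; simp [hj]
  · simp

theorem shiftHom_xMono_of_lt {q : K} (hq : q ≠ 0) (hn : n ≤ N) (θ : Fin n → ℕ) (i : Fin n) :
    shiftHom N q i (xMono N K θ) = (q ^ θ i)⁻¹ • xMono N K θ := by
  have hi := i.2
  have : ∀ j : Fin n, shiftHom N q i (xRatio N K j n) =
      (if j = i then q⁻¹ else 1) • xRatio N K j n := fun j => by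
    rw [shiftHom_xRatio]
    congr 1
    by_cases hj : j = i
    · subst hj; simp; omega
    · have hj' : (j : ℕ) ≠ i := fun e => hj (Fin.ext e)
      rw [if_neg hj]
      by_cases h : (j : ℕ) < i
      -- For `j < i < n` the ratio `x_n/x_j` contains both `y_{i-1}` and `y_i`, and their factors
      -- cancel.
      · rw [if_pos (by omega), if_pos (by omega), mul_inv_cancel₀ hq]
      · rw [if_neg (by omega), if_neg (by omega), mul_one]
  rw [xMono, map_prod]
  simp only [map_pow, this, smul_pow, Finset.prod_smul, ite_pow, one_pow]
  simp

theorem shiftHom_xMono_last (q : K) (hn : n ≤ N) (θ : Fin n → ℕ) :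
    shiftHom N q n (xMono N K θ) = (q ^ ∑ i, θ i) • xMono N K θ := by
  have : ∀ j : Fin n, shiftHom N q n (xRatio N K j n) = q • xRatio N K j n := fun j => by
    rw [shiftHom_xRatio, if_pos (by have := j.2; omega), if_neg (by omega), mul_one]
  rw [xMono, map_prod]
  simp only [map_pow, this, smul_pow, Finset.prod_smul, Finset.prod_pow_eq_pow_sum]

end

end QToda

/-! ### A-type functions and their branching -/

namespace QToda

noncomputable section

open scoped MvPowerSeries.WithPiTopology

variable {N : ℕ} {K : Type*} [Field K] {n : ℕ}

/-- The summands of the `A`-type Toda function in the first `n` of the variables `x_1, …, x_N`. -/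
def partialTermA (N : ℕ) (q : K) (s : Fin n → K) (θ : UpperMatrix n) : LambdaB N K :=
  cToda θ.1 s q • ∏ i : Fin n, ∏ j : Fin n with i < j, xRatio N K i j ^ θ.1 i j

/-- The `A`-type Toda function in the first `n` of the variables `x_1, …, x_N`. -/
def partialTodaA (N : ℕ) (q : K) (s : Fin n → K) : LambdaB N K :=
  formalSum (partialTermA N q s)

theorem UpperMatrix.ext' {θ η : UpperMatrix n} (h : ∀ i j, i < j → θ.1 i j = η.1 i j) :
    θ = η := by
  apply Subtype.ext
  ext i j
  by_cases hij : i < j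
  · exact h i j hij
  · rw [θ.2 i j (not_lt.mp hij), η.2 i j (not_lt.mp hij)]

/-- Extend a strictly upper triangular matrix by a last column. -/
def UpperMatrix.snoc (θ : Fin n → ℕ) (η : UpperMatrix n) : UpperMatrix (n + 1) :=
  ⟨Fin.lastCases (fun _ => 0) fun i => Fin.lastCases (θ i) fun j => η.1 i j, by
    intro k l h
    induction k using Fin.lastCases with
    | last => simp
    | cast k =>
      induction l using Fin.lastCases with
      | last => exact absurd h (Fin.castSucc_lt_last k).not_ge
      | cast l => simpa using η.2 k l (by simpa using h)⟩

@[simp] theorem UpperMatrix.snoc_castSucc_castSucc (θ : Fin n → ℕ) (η : UpperMatrix n)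
    (i j : Fin n) : (snoc θ η).1 i.castSucc j.castSucc = η.1 i j := by
  simp [snoc]

@[simp] theorem UpperMatrix.snoc_castSucc_last (θ : Fin n → ℕ) (η : UpperMatrix n)
    (i : Fin n) : (snoc θ η).1 i.castSucc (Fin.last n) = θ i := by
  simp [snoc]

@[simp] theorem UpperMatrix.snoc_last (θ : Fin n → ℕ) (η : UpperMatrix n)
    (j : Fin (n + 1)) : (snoc θ η).1 (Fin.last n) j = 0 := by
  simp [snoc]

theorem UpperMatrix.snoc_bijective :
    Function.Bijective fun p : (Fin n → ℕ) × UpperMatrix n => snoc p.1 p.2 := by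
  constructor
  · rintro ⟨θ, η⟩ ⟨θ', η'⟩ h
    have h' : ∀ i j, (snoc θ η).1 i j = (snoc θ' η').1 i j := fun i j => by
      simp only at h
      rw [h]
    refine Prod.ext (funext fun i => ?_) (UpperMatrix.ext' fun i j _ => ?_)
    · simpa using h' i.castSucc (Fin.last n)
    · simpa using h' i.castSucc j.castSucc
  · intro Θ
    refine ⟨⟨fun i => Θ.1 i.castSucc (Fin.last n), ⟨fun i j => Θ.1 i.castSucc j.castSucc, ?_⟩⟩, ?_⟩
    · intro k l h
      exact Θ.2 _ _ (by simpa using h)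
    · refine UpperMatrix.ext' fun i j h => ?_
      induction i using Fin.lastCases with
      | last => exact absurd h (Fin.le_last j).not_gt
      | cast i =>
        induction j using Fin.lastCases with
        | last => exact UpperMatrix.snoc_castSucc_last _ _ _
        | cast j => exact UpperMatrix.snoc_castSucc_castSucc _ _ _ _

/-- In the columns before the last, `θ` enters only through the powers `q^{±(θ_i - θ_l)}`, which are
absorbed by replacing `s` with `q^{-θ} s`. The last column itself gives `branchCoeffA`. -/
theorem cToda_snoc {q : K} {s : Fin (n + 1) → K} (hs : IsGeneric q s) (θ : Fin n → ℕ)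
    (η : UpperMatrix n) :
    cToda (UpperMatrix.snoc θ η).1 s q =
      branchCoeffA q s θ * cToda η.1 (shiftBy q θ fun i => s i.castSucc) q := by
  have hq := hs.q_ne_zero
  have hlast : ∀ k : Fin n, ¬ Fin.last n ≤ k.castSucc := fun k => (Fin.castSucc_lt_last k).not_ge
  have hlast' : ∀ k : Fin (n + 1), ¬ Fin.last n < k := fun k => (Fin.le_last k).not_gt
  have e1 : ∀ (S : ℤ) (i l : Fin n), q ^ (S + ((θ i : ℤ) - θ l)) * q * s l.castSucc /
      s i.castSucc = q ^ S * q * shiftBy q θ (fun i => s i.castSucc) l /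
        shiftBy q θ (fun i => s i.castSucc) i := fun S i l => by
    have h1 := hs.ne_zero i.castSucc
    have h2 : q ^ θ i ≠ 0 := pow_ne_zero _ hq
    have h3 : q ^ θ l ≠ 0 := pow_ne_zero _ hq
    simp only [shiftBy, zpow_add₀ hq, zpow_sub₀ hq, zpow_neg, zpow_natCast]
    field_simp
  have e2 : ∀ (S T : ℤ) (i j : Fin n), q ^ (T - (S + ((θ i : ℤ) - θ j))) * q * s i.castSucc /
      s j.castSucc = q ^ (T - S) * q * shiftBy q θ (fun i => s i.castSucc) i /
        shiftBy q θ (fun i => s i.castSucc) j := fun S T i j => by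
    have h1 := hs.ne_zero j.castSucc
    have h2 : q ^ θ i ≠ 0 := pow_ne_zero _ hq
    have h3 : q ^ θ j ≠ 0 := pow_ne_zero _ hq
    have h4 : q ^ S ≠ 0 := zpow_ne_zero _ hq
    simp only [shiftBy, zpow_add₀ hq, zpow_sub₀ hq, zpow_neg, zpow_natCast]
    field_simp
  -- In the last column, the index `l = n` yields the symbol with the last parameter and `j = i`
  -- yields `(q;q)_{θ_i}`; together they form `singleCoeff`, and the remaining indices form
  -- `pairProd`.
  have e3 : (∏ i : Fin n, ((∏ l : Fin n, if i < l then
        1 / qPoch (q * s l.castSucc / s i.castSucc) q (θ i) else 1) *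
          (1 / qPoch (q * s (Fin.last n) / s i.castSucc) q (θ i)))) *
      (∏ i : Fin n, ∏ j : Fin n, if i ≤ j then q ^ θ i /
        qPoch (q ^ ((θ j : ℤ) - θ i) * q * s i.castSucc / s j.castSucc) q (θ i) else 1) =
      branchCoeffA q s θ := by
    rw [branchCoeffA, pairProd, ← Finset.prod_mul_distrib, ← Finset.prod_mul_distrib]
    refine Finset.prod_congr rfl fun i _ => ?_
    have h1 : (∏ j : Fin n, if i ≤ j then q ^ θ i /
        qPoch (q ^ ((θ j : ℤ) - θ i) * q * s i.castSucc / s j.castSucc) q (θ i) else 1) =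
        q ^ θ i / qPoch q q (θ i) * ∏ j : Fin n with i < j, q ^ θ i /
        qPoch (q ^ ((θ j : ℤ) - θ i) * q * s i.castSucc / s j.castSucc) q (θ i) := by
      have h0 : (Finset.univ.filter fun j => i ≤ j) =
          insert i (Finset.univ.filter fun j => i < j) := by
        ext j
        simp only [Finset.mem_filter, Finset.mem_univ, true_and, Finset.mem_insert]
        rw [le_iff_eq_or_lt, eq_comm]
      rw [← Finset.prod_filter, h0, Finset.prod_insert (by simp), sub_self, zpow_zero, one_mul,
        mul_div_cancel_right₀ _ (hs.ne_zero _)]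
    rw [h1, ← Finset.prod_filter, singleCoeff]
    have h2 : ∀ j : Fin n, pairCoeff q (s i.castSucc) (s j.castSucc) (θ i) (θ j) =
        1 / qPoch (q * s j.castSucc / s i.castSucc) q (θ i) * (q ^ θ i /
        qPoch (q ^ ((θ j : ℤ) - θ i) * q * s i.castSucc / s j.castSucc) q (θ i)) := fun j => by
      rw [pairCoeff]; ring
    simp only [h2, Finset.prod_mul_distrib]
    ring
  rw [← e3]
  simp only [cToda, Finset.prod_filter, Finset.sum_filter, Fin.prod_univ_castSucc,
    Fin.sum_univ_castSucc, Fin.castSucc_lt_castSucc_iff, Fin.castSucc_le_castSucc_iff,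
    Fin.castSucc_lt_last, Fin.le_last, hlast, hlast', if_true, if_false, and_true, and_false,
    true_and, false_and, mul_one, Finset.prod_const_one, UpperMatrix.snoc_castSucc_castSucc,
    UpperMatrix.snoc_castSucc_last, UpperMatrix.snoc_last, e1, e2, le_refl,
    (Fin.castSucc_lt_last _).le]
  simp
  ring

theorem partialTermA_snoc {q : K} {s : Fin (n + 1) → K} (hs : IsGeneric q s) (θ : Fin n → ℕ)
    (η : UpperMatrix n) :
    partialTermA N q s (UpperMatrix.snoc θ η) = branchCoeffA q s θ •
      (xMono N K θ * partialTermA N q (shiftBy q θ fun i => s i.castSucc) η) := by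
  have hlast' : ∀ k : Fin (n + 1), ¬ Fin.last n < k := fun k => (Fin.le_last k).not_gt
  rw [partialTermA, partialTermA, cToda_snoc hs, mul_smul_comm, smul_smul]
  congr 1
  simp only [Finset.prod_filter, Fin.prod_univ_castSucc, Fin.castSucc_lt_castSucc_iff,
    Fin.castSucc_lt_last, if_true, hlast', if_false, UpperMatrix.snoc_castSucc_castSucc,
    UpperMatrix.snoc_castSucc_last, Finset.prod_const_one, mul_one, Finset.prod_mul_distrib,
    xMono, Fin.val_castSucc, Fin.val_last]
  rw [mul_comm]

/-- The family `∏ (x_n / x_i) ^ θ_i f(x | q ^ {-θ} s)` into which Toda functions are expanded. -/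
def todaBasis (N : ℕ) (q : K) (s : Fin n → K) (θ : Fin n → ℕ) : LambdaB N K :=
  xMono N K θ * partialTodaA N q (shiftBy q θ s)

theorem xRatio_mul_todaBasis {q : K} (hq : q ≠ 0) (s : Fin n → K) (θ : Fin n → ℕ) (i : Fin n) :
    xRatio N K i n * todaBasis N q (shiftBy q (Pi.single i 1) s) θ =
      todaBasis N q s (θ + Pi.single i 1) := by
  rw [todaBasis, todaBasis, ← mul_assoc, xRatio_mul_xMono, shiftBy_add hq]

section Summation

variable [TopologicalSpace K]

theorem summable_partialTermA (hn : n ≤ N) (q : K) (s : Fin n → K) :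
    Summable (partialTermA N q s) := by
  refine summable_of_X_pow_dvd (κ := Fin n × Fin n) (e := fun θ p => θ.1 p.1 p.2) ?_
    (fun p => Fin.castLE hn p.1) ?_
  · intro θ η h
    exact UpperMatrix.ext' fun i j _ => congrFun h (i, j)
  · rintro θ ⟨i, j⟩
    by_cases hij : i < j
    swap
    · simp [θ.2 i j (not_lt.mp hij)]
    have h2 := (pow_dvd_pow_of_dvd (X_dvd_xRatio (K := K) (Fin.castLE hn i).2
      (show (i : ℕ) < j from hij)) (θ.1 i j)).trans
        (Finset.dvd_prod_of_mem (fun j : Fin n => xRatio N K i j ^ θ.1 i j)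
          (show j ∈ Finset.univ.filter (fun j => i < j) by simpa using hij))
    have h3 := h2.trans (Finset.dvd_prod_of_mem
        (fun i : Fin n => ∏ j : Fin n with i < j, xRatio N K i j ^ θ.1 i j) (Finset.mem_univ i))
    unfold partialTermA
    rw [MvPowerSeries.smul_eq_C_mul]
    exact h3.mul_left _

theorem summable_smul_todaBasis (hn : n ≤ N) (q : K) (s : Fin n → K) (c : (Fin n → ℕ) → K) :
    Summable fun θ => c θ • todaBasis N q s θ := by
  refine summable_of_X_pow_dvd (e := fun θ => θ) Function.injective_id (fun i => Fin.castLE hn i) ?_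
  intro θ i
  rw [MvPowerSeries.smul_eq_C_mul]
  refine Dvd.dvd.mul_left (Dvd.dvd.mul_right ?_ _) _
  exact (pow_dvd_pow_of_dvd (X_dvd_xRatio (K := K) (Fin.castLE hn i).2 i.2) (θ i)).trans
    (Finset.dvd_prod_of_mem (fun j : Fin n => xRatio N K j n ^ θ j) (Finset.mem_univ i))

variable [DiscreteTopology K]

theorem hasSum_partialTodaA (hn : n ≤ N) (q : K) (s : Fin n → K) :
    HasSum (partialTermA N q s) (partialTodaA N q s) :=
  hasSum_formalSum (summable_partialTermA hn q s)

/-- The branching formula for the `A`-type Toda function. -/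
theorem hasSum_branchCoeffA (hn : n + 1 ≤ N) {q : K} {s : Fin (n + 1) → K} (hs : IsGeneric q s) :
    HasSum (fun θ => branchCoeffA q s θ • todaBasis N q (fun i => s i.castSucc) θ)
      (partialTodaA N q s) := by
  have h := hasSum_partialTodaA hn q s
  rw [← (Equiv.ofBijective _ UpperMatrix.snoc_bijective).hasSum_iff] at h
  -- The sum over matrices is carried out with the last column `θ` fixed.
  refine h.prod_fiberwise fun θ => ?_
  simp only [Function.comp_def, Equiv.ofBijective_apply, partialTermA_snoc hs]
  exact ((hasSum_partialTodaA (by omega) q _).mul_left _).const_smul _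

theorem shiftHom_partialTodaA (hn : n ≤ N) (q r : K) (s : Fin n → K) :
    shiftHom N r n (partialTodaA N q s) = partialTodaA N q s := by
  have h := hasSum_partialTodaA hn q s
  have h' := h.map (shiftHom N r n) (continuous_shiftHom r n)
  refine h'.unique ?_
  convert h using 1
  ext1 θ
  rw [Function.comp_apply, partialTermA, shiftHom_smul, map_prod]
  congr 1
  refine Finset.prod_congr rfl fun i _ => ?_
  rw [map_prod]
  refine Finset.prod_congr rfl fun j _ => ?_
  rw [map_pow, shiftHom_xRatio, if_neg (by omega), if_neg (by omega), mul_one, one_smul]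

theorem shiftHom_todaBasis (hn : n ≤ N) (q r : K) (s : Fin n → K) (θ : Fin n → ℕ) :
    shiftHom N r n (todaBasis N q s θ) = (r ^ ∑ i, θ i) • todaBasis N q s θ := by
  rw [todaBasis, map_mul, shiftHom_xMono_last r hn, shiftHom_partialTodaA hn, smul_mul_assoc]

end Summation

end

end QToda

/-! ### Pieri formulas and Toda operators -/

namespace QToda

noncomputable section

open scoped MvPowerSeries.WithPiTopology

variable {N : ℕ} {K : Type*} [Field K] {n : ℕ}

section Pieri

variable [TopologicalSpace K] [DiscreteTopology K]

/-- All terms expand in one basis: shifting the last parameter leaves the first `n` alone, and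
shifting `s_i` becomes a step `θ → θ + e_i` once multiplied by `x_n/x_i`. The weights `c` are free
because the two Pieri formulas use `c = 1` and `c = s`. -/
theorem hasSum_pieri (hn : n + 1 ≤ N) {q : K} {s : Fin (n + 1) → K} (hs : IsGeneric q s)
    (c : Fin (n + 1) → K) :
    HasSum (fun θ => (c (Fin.last n) * branchCoeffA q (shiftBy q (Pi.single (Fin.last n) 1) s) θ +
        ∑ i : Fin n, lower i (fun η => c i.castSucc * pieriCoeff q s i.castSucc *
          branchCoeffA q (shiftBy q (Pi.single i.castSucc 1) s) η) θ) •
        todaBasis N q (fun i => s i.castSucc) θ)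
      (c (Fin.last n) • partialTodaA N q (shiftBy q (Pi.single (Fin.last n) 1) s) +
        ∑ i : Fin n, (c i.castSucc * pieriCoeff q s i.castSucc) • (xRatio N K i n *
          partialTodaA N q (shiftBy q (Pi.single i.castSucc 1) s))) := by
  simp only [add_smul, Finset.sum_smul]
  refine HasSum.add ?_ (hasSum_sum fun i _ => ?_)
  · have h := (hasSum_branchCoeffA hn (hs.shiftBy (Pi.single (Fin.last n) 1))).const_smul
      (c (Fin.last n))
    have h0 : (fun i : Fin n => shiftBy q (Pi.single (Fin.last n) 1) s i.castSucc) =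
        fun i => s i.castSucc :=
      funext fun i => shiftBy_single_of_ne (Fin.castSucc_lt_last i).ne
    rw [h0] at h
    simpa only [smul_smul] using h
  · rw [hasSum_lower_iff]
    have h := ((hasSum_branchCoeffA hn (hs.shiftBy (Pi.single i.castSucc 1))).mul_left
      (xRatio N K i n)).const_smul (c i.castSucc * pieriCoeff q s i.castSucc)
    rw [shiftBy_single_castSucc] at h
    simpa only [mul_smul_comm, smul_smul, xRatio_mul_todaBasis hs.q_ne_zero] using h

/-- The Pieri-type formula for multiplication by `x_{n+1} / x_n`. -/
theorem xRatio_mul_partialTodaA (hn : n + 1 ≤ N) {q : K} {s : Fin (n + 1) → K}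
    (hs : IsGeneric q s) :
    xRatio N K n (n + 1) * partialTodaA N q s =
      ∑ i : Fin (n + 1), pieriCoeff q s i • (xRatio N K i (n + 1) *
        partialTodaA N q (shiftBy q (Pi.single i 1) s)) := by
  have h := hasSum_pieri hn hs fun _ => 1
  simp only [one_mul] at h
  have h1 := branchCoeffA_pieri hs
  simp only [one_mul] at h1
  simp only [h1] at h
  rw [← h.unique (hasSum_branchCoeffA hn hs), one_smul, mul_add, Fin.sum_univ_castSucc,
    pieriCoeff_last, one_smul, add_comm, Finset.mul_sum]
  congr 1
  refine Finset.sum_congr rfl fun i _ => ?_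
  rw [mul_smul_comm, ← mul_assoc, mul_comm (xRatio N K n _), Fin.val_castSucc,
    xRatio_mul_xRatio i.2.le (Nat.le_succ n)]

/-- The Pieri-type formula for the operator `(x_{n+1} / x_n) T_{q,x_n}`. -/
theorem xRatio_mul_shiftHom_partialTodaA (hn : n + 1 ≤ N) {q : K} {s : Fin (n + 1) → K}
    (hs : IsGeneric q s) :
    s (Fin.last n) • (xRatio N K n (n + 1) * shiftHom N q n (partialTodaA N q s)) =
      ∑ i : Fin (n + 1), (pieriCoeff q s i * s i) • (xRatio N K i (n + 1) *
        partialTodaA N q (shiftBy q (Pi.single i 1) s)) := by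
  have h := hasSum_pieri hn hs s
  simp only [branchCoeffA_pieri_mul hs] at h
  have h2 : HasSum (fun θ => (branchCoeffA q s θ * (s (Fin.last n) * q ^ ∑ i, θ i)) •
      todaBasis N q (fun i => s i.castSucc) θ)
      (s (Fin.last n) • shiftHom N q n (partialTodaA N q s)) := by
    have := ((hasSum_branchCoeffA hn hs).map (shiftHom N q n)
      (continuous_shiftHom q n)).const_smul (s (Fin.last n))
    simp only [Function.comp_def, shiftHom_smul, shiftHom_todaBasis (Nat.le_of_succ_le hn),
      smul_smul] at this
    convert this using 3 with θ
    ring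
  rw [← mul_smul_comm, ← h.unique h2, mul_add, Fin.sum_univ_castSucc,
    pieriCoeff_last, one_mul, add_comm, Finset.mul_sum, mul_smul_comm]
  congr 1
  refine Finset.sum_congr rfl fun i _ => ?_
  rw [mul_smul_comm, ← mul_assoc, mul_comm (xRatio N K n _), Fin.val_castSucc,
    xRatio_mul_xRatio i.2.le (Nat.le_succ n), mul_comm (s _)]

end Pieri

/-- The `A`-type Toda operator in the first `n` of the variables. -/
def todaOpA (N : ℕ) (q : K) (s : Fin n → K) : LambdaB N K →ₗ[K] LambdaB N K :=
  ∑ i : Fin n, s i • (LinearMap.mulLeft K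
    (1 - if (i : ℕ) + 1 < n then xRatio N K i (i + 1) else 0)).comp (shiftLinear N q i)

/-- The `A`-type Toda operator with inverse shifts in the first `n` of the variables. -/
def todaOpAInv (N : ℕ) (q : K) (s : Fin n → K) : LambdaB N K →ₗ[K] LambdaB N K :=
  ∑ i : Fin n, (s i)⁻¹ • (LinearMap.mulLeft K
    (1 - if (i : ℕ) = 0 then 0 else xRatio N K ((i : ℕ) - 1) i)).comp (shiftLinear N q⁻¹ i)

/-- The boundary operator `s_n (x_{n+1} / x_n) T_{q,x_n}` (zero for `n = 0`). -/
def boundaryOp (N : ℕ) (q : K) (s : Fin n → K) : LambdaB N K →ₗ[K] LambdaB N K :=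
  ∑ i : Fin n, if (i : ℕ) + 1 = n then
    s i • (LinearMap.mulLeft K (xRatio N K i n)).comp (shiftLinear N q i) else 0

theorem todaOpA_apply (q : K) (s : Fin n → K) (f : LambdaB N K) :
    todaOpA N q s f = ∑ i : Fin n, s i •
      ((1 - if (i : ℕ) + 1 < n then xRatio N K i (i + 1) else 0) * shiftHom N q i f) := by
  simp [todaOpA, shiftLinear]

theorem todaOpAInv_apply (q : K) (s : Fin n → K) (f : LambdaB N K) :
    todaOpAInv N q s f = ∑ i : Fin n, (s i)⁻¹ •
      ((1 - if (i : ℕ) = 0 then 0 else xRatio N K ((i : ℕ) - 1) i) * shiftHom N q⁻¹ i f) := by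
  simp [todaOpAInv, shiftLinear]

theorem boundaryOp_succ_apply (q : K) (s : Fin (n + 1) → K) (f : LambdaB N K) :
    boundaryOp N q s f =
      s (Fin.last n) • (xRatio N K n (n + 1) * shiftHom N q n f) := by
  rw [boundaryOp, Finset.sum_eq_single (Fin.last n)]
  · simp [shiftLinear]
  · intro i _ hi
    rw [if_neg]
    intro h
    exact hi (Fin.ext (by simpa using h))
  · simp

/-- With one more variable, the formerly last term acquires its factor `1 - x_n/x_{n-1}`, whence the
boundary operator. -/
theorem todaOpA_succ_apply (q : K) (s : Fin (n + 1) → K) (f : LambdaB N K) :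
    todaOpA N q s f = todaOpA N q (fun i : Fin n => s i.castSucc) f -
      boundaryOp N q (fun i : Fin n => s i.castSucc) f + s (Fin.last n) • shiftHom N q n f := by
  rw [todaOpA_apply, todaOpA_apply, Fin.sum_univ_castSucc]
  congr 1
  · rw [boundaryOp, LinearMap.sum_apply, ← Finset.sum_sub_distrib]
    refine Finset.sum_congr rfl fun i _ => ?_
    have hi := i.2
    simp only [Fin.val_castSucc]
    rw [if_pos (by omega)]
    by_cases h : (i : ℕ) + 1 = n
    · rw [if_neg (by omega), if_pos h]
      simp [shiftLinear, sub_mul, h, smul_sub]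
    · rw [if_pos (by omega), if_neg h]
      simp
  · simp

theorem todaOpAInv_succ_apply (q : K) (s : Fin (n + 1) → K) (f : LambdaB N K) :
    todaOpAInv N q s f = todaOpAInv N q (fun i : Fin n => s i.castSucc) f +
      (s (Fin.last n))⁻¹ • ((1 - if n = 0 then 0 else xRatio N K (n - 1) n) *
        shiftHom N q⁻¹ n f) := by
  rw [todaOpAInv_apply, todaOpAInv_apply, Fin.sum_univ_castSucc]
  rfl

theorem continuous_todaOpA [TopologicalSpace K] [DiscreteTopology K] (q : K) (s : Fin n → K) :
    Continuous (todaOpA N q s) := by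
  simp only [funext (todaOpA_apply q s)]
  exact continuous_finsetSum _ fun i _ =>
    Continuous.const_smul (Continuous.mul continuous_const (continuous_shiftHom q i)) (s i)

theorem continuous_todaOpAInv [TopologicalSpace K] [DiscreteTopology K] (q : K) (s : Fin n → K) :
    Continuous (todaOpAInv N q s) := by
  simp only [funext (todaOpAInv_apply q s)]
  exact continuous_finsetSum _ fun i _ =>
    Continuous.const_smul (Continuous.mul continuous_const (continuous_shiftHom q⁻¹ i)) (s i)⁻¹

theorem continuous_boundaryOp [TopologicalSpace K] [DiscreteTopology K] (q : K) (s : Fin n → K) :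
    Continuous (boundaryOp N q s) := by
  cases n with
  | zero => exact continuous_of_const fun f g => by simp [boundaryOp]
  | succ n =>
    simp only [funext (boundaryOp_succ_apply q s)]
    exact Continuous.const_smul (Continuous.mul continuous_const (continuous_shiftHom q n))
      (s (Fin.last n))

/-- The shift of `x_i` multiplies the monomial by `q^{-θ_i}`, which is absorbed into `s_i`. -/
theorem todaOpA_xMono_mul {q : K} (hq : q ≠ 0) (hn : n ≤ N) (s : Fin n → K) (θ : Fin n → ℕ)
    (f : LambdaB N K) :
    todaOpA N q s (xMono N K θ * f) = xMono N K θ * todaOpA N q (shiftBy q θ s) f := by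
  rw [todaOpA_apply, todaOpA_apply, Finset.mul_sum]
  refine Finset.sum_congr rfl fun i _ => ?_
  rw [map_mul, shiftHom_xMono_of_lt hq hn, smul_mul_assoc, mul_smul_comm, smul_smul,
    mul_smul_comm, mul_left_comm]
  congr 1
  simp [shiftBy, mul_comm]

theorem todaOpAInv_xMono_mul {q : K} (hq : q ≠ 0) (hn : n ≤ N) (s : Fin n → K) (θ : Fin n → ℕ)
    (f : LambdaB N K) :
    todaOpAInv N q s (xMono N K θ * f) = xMono N K θ * todaOpAInv N q (shiftBy q θ s) f := by
  rw [todaOpAInv_apply, todaOpAInv_apply, Finset.mul_sum]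
  refine Finset.sum_congr rfl fun i _ => ?_
  rw [map_mul, shiftHom_xMono_of_lt (inv_ne_zero hq) hn, smul_mul_assoc, mul_smul_comm, smul_smul,
    mul_smul_comm, mul_left_comm]
  congr 1
  simp [shiftBy, mul_comm]

theorem boundaryOp_xMono_mul {q : K} (hq : q ≠ 0) (hn : n ≤ N) (s : Fin n → K) (θ : Fin n → ℕ)
    (f : LambdaB N K) :
    boundaryOp N q s (xMono N K θ * f) = xMono N K θ * boundaryOp N q (shiftBy q θ s) f := by
  cases n with
  | zero => simp [boundaryOp]
  | succ n =>
    have h := shiftHom_xMono_of_lt hq hn θ (Fin.last n)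
    rw [Fin.val_last] at h
    rw [boundaryOp_succ_apply, boundaryOp_succ_apply, map_mul, h,
      smul_mul_assoc, mul_smul_comm, smul_smul, mul_smul_comm, mul_left_comm]
    congr 1
    simp [shiftBy, mul_comm]

/-! ### Eigenvalue equations for the A-type functions -/

section Eigen

variable [TopologicalSpace K] [DiscreteTopology K]

theorem boundaryOp_todaBasis (hn : n ≤ N) {q : K} {s : Fin n → K} (hs : IsGeneric q s)
    (θ : Fin n → ℕ) :
    boundaryOp N q s (todaBasis N q s θ) = ∑ i, (pieriCoeff q (shiftBy q θ s) i *
      shiftBy q θ s i) • todaBasis N q s (θ + Pi.single i 1) := by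
  rw [todaBasis, boundaryOp_xMono_mul hs.q_ne_zero hn]
  cases n with
  | zero => simp [boundaryOp]
  | succ n =>
    rw [boundaryOp_succ_apply, xRatio_mul_shiftHom_partialTodaA hn (hs.shiftBy θ), Finset.mul_sum]
    refine Finset.sum_congr rfl fun i _ => ?_
    rw [todaBasis, mul_smul_comm, ← mul_assoc, mul_comm (xMono _ _ _), xRatio_mul_xMono,
      add_comm θ, shiftBy_add hs.q_ne_zero]

theorem xRatio_mul_todaBasis_eq_sum (hn : n + 1 ≤ N) {q : K} {s : Fin (n + 1) → K}
    (hs : IsGeneric q s) (θ : Fin (n + 1) → ℕ) :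
    xRatio N K n (n + 1) * todaBasis N q s θ = ∑ i, pieriCoeff q (shiftBy q θ s) i •
      todaBasis N q s (θ + Pi.single i 1) := by
  rw [todaBasis, mul_left_comm, xRatio_mul_partialTodaA hn (hs.shiftBy θ), Finset.mul_sum]
  refine Finset.sum_congr rfl fun i _ => ?_
  rw [todaBasis, mul_smul_comm, ← mul_assoc, mul_comm (xMono _ _ _), xRatio_mul_xMono,
    add_comm θ, shiftBy_add hs.q_ne_zero]

/-- On the branching basis, the induction hypothesis at `q^{-θ} s` and the shift of `x_n` give the
diagonal part; the boundary operator gives the raising part by the second Pieri formula. -/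
theorem todaOpA_partialTodaA (hn : n ≤ N) {q : K} {s : Fin n → K} (hs : IsGeneric q s) :
    todaOpA N q s (partialTodaA N q s) = (∑ i, s i) • partialTodaA N q s := by
  induction n with
  | zero => simp [todaOpA]
  | succ n ih =>
    have hn' : n ≤ N := by omega
    refine eigen_of_recursion (summable_smul_todaBasis hn' q _) (hasSum_branchCoeffA hn hs)
      (todaOpA N q s) (continuous_todaOpA q s)
      (d := fun θ => ∑ i, shiftBy q θ (fun i : Fin n => s i.castSucc) i +
        s (Fin.last n) * q ^ ∑ i, θ i)
      (a := fun i η => pieriCoeff q (shiftBy q η fun i => s i.castSucc) i *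
          shiftBy q η (fun i => s i.castSucc) i) (fun θ => ?_) (branchCoeffA_eigen hs)
    rw [todaOpA_succ_apply, boundaryOp_todaBasis hn' hs.castSucc, shiftHom_todaBasis hn']
    have : todaOpA N q (fun i : Fin n => s i.castSucc)
        (todaBasis N q (fun i => s i.castSucc) θ) =
        (∑ i, shiftBy q θ (fun i : Fin n => s i.castSucc) i) •
          todaBasis N q (fun i => s i.castSucc) θ := by
      rw [todaBasis, todaOpA_xMono_mul hs.q_ne_zero hn', ih hn' (hs.castSucc.shiftBy θ),
        mul_smul_comm]
    rw [this, smul_smul, add_smul]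
    abel

/-- The raising part now comes from the factor `x_n/x_{n-1}` of the new term, so the first Pieri
formula is the relevant one. -/
theorem todaOpAInv_partialTodaA (hn : n ≤ N) {q : K} {s : Fin n → K} (hs : IsGeneric q s) :
    todaOpAInv N q s (partialTodaA N q s) = (∑ i, (s i)⁻¹) • partialTodaA N q s := by
  induction n with
  | zero => simp [todaOpAInv]
  | succ n ih =>
    have hn' : n ≤ N := by omega
    refine eigen_of_recursion (summable_smul_todaBasis hn' q _) (hasSum_branchCoeffA hn hs)
      (todaOpAInv N q s) (continuous_todaOpAInv q s)
      (d := fun θ => ∑ i, (shiftBy q θ (fun i : Fin n => s i.castSucc) i)⁻¹ +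
        (s (Fin.last n))⁻¹ * (q ^ ∑ i, θ i)⁻¹)
      (a := fun i η => (s (Fin.last n))⁻¹ * (q ^ ∑ i, η i)⁻¹ *
          pieriCoeff q (shiftBy q η fun i => s i.castSucc) i) (fun θ => ?_)
      (branchCoeffA_eigen_inv hs)
    have h1 : todaOpAInv N q (fun i : Fin n => s i.castSucc)
        (todaBasis N q (fun i => s i.castSucc) θ) =
        (∑ i, (shiftBy q θ (fun i : Fin n => s i.castSucc) i)⁻¹) •
          todaBasis N q (fun i => s i.castSucc) θ := by
      rw [todaBasis, todaOpAInv_xMono_mul hs.q_ne_zero hn', ih hn' (hs.castSucc.shiftBy θ),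
        mul_smul_comm]
    have h2 : (if n = 0 then 0 else xRatio N K (n - 1) n) *
        todaBasis N q (fun i => s i.castSucc) θ =
        ∑ i, pieriCoeff q (shiftBy q θ fun i : Fin n => s i.castSucc) i •
          todaBasis N q (fun i => s i.castSucc) (θ + Pi.single i 1) := by
      cases n with
      | zero => simp
      | succ n =>
        rw [if_neg (Nat.succ_ne_zero n)]
        exact xRatio_mul_todaBasis_eq_sum hn' hs.castSucc θ
    rw [todaOpAInv_succ_apply, shiftHom_todaBasis hn', h1, mul_smul_comm, sub_mul, h2, one_mul]
    simp only [smul_sub, Finset.smul_sum, smul_smul, add_smul, inv_pow, add_sub_assoc, mul_assoc]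

end Eigen

end

end QToda

/-! ### Existence of the B-type eigenfunction -/

namespace QToda

noncomputable section

open scoped MvPowerSeries.WithPiTopology

variable {N : ℕ} {K : Type*} [Field K]

theorem todaOpB_eq {q : K} (hq : q ≠ 0) (s : Fin N → K) (f : LambdaB N K) :
    todaOpB q s f = (todaOpA N q s - boundaryOp N q s + todaOpAInv N q s) f := by
  simp only [todaOpB, qShift_eq_shiftHom hq, qShift_eq_shiftHom (inv_ne_zero hq),
    LinearMap.add_apply, LinearMap.sub_apply, todaOpA_apply, todaOpAInv_apply]
  congr 1
  rw [boundaryOp, LinearMap.sum_apply, ← Finset.sum_sub_distrib]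
  refine Finset.sum_congr rfl fun i _ => ?_
  have hi := i.2
  by_cases h : (i : ℕ) + 1 = N
  · rw [if_neg (by omega), if_pos h]
    simp [shiftLinear, sub_mul, h, smul_sub]
  · rw [if_pos (by omega), if_neg h]
    simp

theorem constantCoeff_xRatio {a b : ℕ} (ha : a < N) (hab : a < b) :
    MvPowerSeries.constantCoeff (xRatio N K a b) = 0 := by
  obtain ⟨g, hg⟩ := X_dvd_xRatio (K := K) ha hab
  rw [hg, map_mul, MvPowerSeries.constantCoeff_X, zero_mul]

theorem constantCoeff_xMono {n : ℕ} (hn : n ≤ N) {θ : Fin n → ℕ} (h : θ ≠ 0) :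
    MvPowerSeries.constantCoeff (xMono N K θ) = 0 := by
  obtain ⟨i, hi⟩ := Function.ne_iff.mp h
  rw [xMono, map_prod]
  refine Finset.prod_eq_zero (Finset.mem_univ i) ?_
  rw [map_pow, constantCoeff_xRatio (i.2.trans_le hn) i.2, zero_pow hi]

theorem xMono_zero {n : ℕ} : xMono N K (0 : Fin n → ℕ) = 1 := by
  simp [xMono]

theorem pairCoeff_zero (q a b : K) (m : ℕ) : pairCoeff q a b 0 m = 1 := by
  simp [pairCoeff, qPoch]

theorem branchCoeffA_zero {n : ℕ} (q : K) (s : Fin (n + 1) → K) : branchCoeffA q s 0 = 1 := by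
  simp [branchCoeffA, pairProd, pairCoeff_zero, singleCoeff, qPoch]

theorem eCoeff_zero (q : K) (s : Fin N → K) : eCoeff q s 0 = 1 := by
  simp [eCoeff, qPoch]

theorem shiftBy_zero {n : ℕ} (q : K) (s : Fin n → K) : shiftBy q 0 s = s := by
  ext i; simp [shiftBy]

section Existence

variable [TopologicalSpace K] [DiscreteTopology K]

theorem constantCoeff_of_hasSum {n : ℕ} (hn : n ≤ N) {c : (Fin n → ℕ) → K}
    {g : (Fin n → ℕ) → LambdaB N K} {f : LambdaB N K}
    (h : HasSum (fun θ => c θ • (xMono N K θ * g θ)) f) (hc : c 0 = 1)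
    (hg : MvPowerSeries.constantCoeff (g 0) = 1) : MvPowerSeries.constantCoeff f = 1 := by
  have h1 := h.map (MvPowerSeries.constantCoeff (σ := Fin N) (R := K))
    (MvPowerSeries.WithPiTopology.continuous_constantCoeff K)
  have h2 := hasSum_single (f := fun θ =>
    MvPowerSeries.constantCoeff (c θ • (xMono N K θ * g θ))) 0 fun θ hθ => by
      rw [MvPowerSeries.smul_eq_C_mul, map_mul, map_mul, constantCoeff_xMono hn hθ]
      simp
  rw [h1.unique h2, xMono_zero, hc, one_smul, one_mul, hg]

theorem constantCoeff_partialTodaA {n : ℕ} (hn : n ≤ N) {q : K} {s : Fin n → K}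
    (hs : IsGeneric q s) : MvPowerSeries.constantCoeff (partialTodaA N q s) = 1 := by
  induction n with
  | zero =>
    have h := hasSum_partialTodaA hn q s
    have : Unique (UpperMatrix 0) :=
      ⟨⟨⟨fun i => i.elim0, fun i => i.elim0⟩⟩, fun θ => Subtype.ext (funext fun i => i.elim0)⟩
    rw [h.unique (hasSum_unique _)]
    simp [partialTermA, cToda]
  | succ n ih =>
    refine constantCoeff_of_hasSum (n := n) (by omega) (hasSum_branchCoeffA hn hs)
      (branchCoeffA_zero q s) ?_
    rw [shiftBy_zero]
    exact ih (by omega) hs.castSucc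

theorem isTodaFunctionB_of_hasSum {q : K} {s : Fin N → K} (hs : IsGenericB q s) {f : LambdaB N K}
    (hf : HasSum (branchingTerm q s) f) : IsTodaFunctionB q s f := by
  have hq := hs.q_ne_zero
  refine ⟨?_, constantCoeff_of_hasSum le_rfl (g := fun θ => partialTodaA N q (shiftBy q θ s)) hf
    (eCoeff_zero q s) (by
      rw [shiftBy_zero]
      exact constantCoeff_partialTodaA le_rfl hs.toIsGeneric)⟩
  rw [todaOpB_eq hq]
  refine eigen_of_recursion (summable_smul_todaBasis le_rfl q s) (c := eCoeff q s) hf _ ?_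
    (d := fun θ => ∑ i, shiftBy q θ s i + ∑ i, (shiftBy q θ s i)⁻¹)
    (a := fun i η => pieriCoeff q (shiftBy q η s) i * shiftBy q η s i) (fun θ => ?_)
    (eCoeff_eigen hs)
  · exact ((continuous_todaOpA q s).sub (continuous_boundaryOp q s)).add
      (continuous_todaOpAInv q s)
  · rw [LinearMap.add_apply, LinearMap.sub_apply, boundaryOp_todaBasis le_rfl hs.toIsGeneric,
      todaBasis, todaOpA_xMono_mul hq le_rfl, todaOpAInv_xMono_mul hq le_rfl,
      todaOpA_partialTodaA le_rfl (hs.toIsGeneric.shiftBy θ),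
      todaOpAInv_partialTodaA le_rfl (hs.toIsGeneric.shiftBy θ), mul_smul_comm, mul_smul_comm,
      add_smul]
    abel

end Existence

theorem exists_isTodaFunctionB {q : K} {s : Fin N → K} (hs : IsGenericB q s) :
    ∃ f, IsTodaFunctionB q s f ∧ HasFormalSum (branchingTerm q s) f := by
  -- For the discrete topology, convergence of a sum of power series is local finiteness in each
  -- coefficient.
  let _ : TopologicalSpace K := ⊥
  have : DiscreteTopology K := ⟨rfl⟩
  obtain ⟨f, hf⟩ : Summable (branchingTerm q s) :=
    -- For `n = N` the branching terms are by definition `eCoeff q s θ • todaBasis N q s θ`.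
    summable_smul_todaBasis le_rfl q s (eCoeff q s)
  exact ⟨f, isTodaFunctionB_of_hasSum hs hf, hasFormalSum_of_hasSum hf⟩

/-! ### Uniqueness by triangularity -/

theorem coeff_X_mul_eq_zero (k : Fin N) {g : LambdaB N K} {m : Fin N →₀ ℕ}
    (h : ∀ m' : Fin N →₀ ℕ, m'.degree < m.degree → MvPowerSeries.coeff m' g = 0) :
    MvPowerSeries.coeff m (MvPowerSeries.X k * g) = 0 := by
  classical
  rw [MvPowerSeries.coeff_mul]
  refine Finset.sum_eq_zero fun p hp => ?_
  rw [Finset.HasAntidiagonal.mem_antidiagonal] at hp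
  by_cases h1 : p.1 = Finsupp.single k 1
  · rw [h p.2, mul_zero]
    rw [← hp, map_add, h1, Finsupp.degree_single]
    omega
  · rw [MvPowerSeries.coeff_X, if_neg h1, zero_mul]

/-- Every non-diagonal term multiplies by some `y_k` and raises the degree, so in lowest degree only
the shifts themselves survive. -/
theorem coeff_todaOpB {q : K} {s : Fin N → K} {f : LambdaB N K} {m : Fin N →₀ ℕ}
    (h : ∀ m' : Fin N →₀ ℕ, m'.degree < m.degree → MvPowerSeries.coeff m' f = 0) :
    MvPowerSeries.coeff m (todaOpB q s f) =
      (∑ i, (s i * q ^ xExponent m i + (s i)⁻¹ * (q ^ xExponent m i)⁻¹)) *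
        MvPowerSeries.coeff m f := by
  have hc : ∀ (r : K) (i : Fin N) (m' : Fin N →₀ ℕ), MvPowerSeries.coeff m' (qShift r i f) =
      r ^ xExponent m' i * MvPowerSeries.coeff m' f := fun r i m' => rfl
  have h0 : ∀ (r : K) (i k : Fin N),
      MvPowerSeries.coeff m (MvPowerSeries.X k * qShift r i f) = 0 := fun r i k =>
    coeff_X_mul_eq_zero k fun m' hm' => by rw [hc, h m' hm', mul_zero]
  have h1 : ∀ i : Fin N, MvPowerSeries.coeff m
      ((1 - if (i : ℕ) = 0 then 0 else xRatio N K ((i : ℕ) - 1) (i : ℕ)) * qShift q⁻¹ i f) =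
      MvPowerSeries.coeff m (qShift q⁻¹ i f) := fun i => by
    split_ifs with hi
    · rw [sub_zero, one_mul]
    · have := xRatio_succ (K := K) (⟨i - 1, by omega⟩ : Fin N)
      simp only [Nat.sub_add_cancel (Nat.one_le_iff_ne_zero.mpr hi)] at this
      rw [sub_mul, one_mul, map_sub, this, h0, sub_zero]
  simp only [todaOpB, map_add, map_sum, map_smul, smul_eq_mul, h1, Finset.sum_add_distrib]
  simp only [xRatio_succ, sub_mul, one_mul,
    map_sub, h0, sub_zero, hc, add_mul, Finset.sum_mul, inv_zpow, mul_assoc]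

theorem exists_xExponent_ne_zero {m : Fin N →₀ ℕ} (hm : m ≠ 0) : ∃ i, xExponent m i ≠ 0 := by
  by_contra! h
  apply hm
  have key : ∀ k : ℕ, ∀ hk : k < N, m ⟨k, hk⟩ = 0 := by
    intro k
    induction k with
    | zero =>
      intro hk
      have := h ⟨0, hk⟩
      simpa [xExponent] using this
    | succ k ih =>
      intro hk
      have h1 := h ⟨k + 1, hk⟩
      have h2 := ih (by omega)
      have h3 : (Finset.univ.filter fun j : Fin N => (j : ℕ) + 1 = k + 1) =
          {⟨k, by omega⟩} := by
        ext j; simp [Fin.ext_iff]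
      simp only [xExponent, h3, Finset.sum_singleton, h2] at h1
      simpa using h1
  ext i
  exact key i i.2

theorem zpow_ne_one {q : K} (hq : ∀ n : ℕ, 0 < n → q ^ n ≠ 1) {e : ℤ} (he : e ≠ 0) :
    q ^ e ≠ 1 := by
  intro h
  obtain ⟨k, rfl | rfl⟩ := e.eq_nat_or_neg
  · exact hq k (by omega) (by simpa using h)
  · exact hq k (by omega) (by simpa using h)

/-- The eigenvalues of the leading part of the `B_N` Toda operator on non-trivial monomials differ
from the eigenvalue on the constants. -/
def HasSimpleSpectrum (q : K) (s : Fin N → K) : Prop :=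
  ∀ e : Fin N → ℤ, e ≠ 0 → ∑ i, (s i * q ^ e i + (s i)⁻¹ * (q ^ e i)⁻¹) ≠ ∑ i, (s i + (s i)⁻¹)

theorem eq_zero_of_todaOpB_eq {q : K} {s : Fin N → K} (hs : HasSimpleSpectrum q s)
    {f : LambdaB N K} (hf : todaOpB q s f = (∑ i, (s i + (s i)⁻¹)) • f)
    (h0 : MvPowerSeries.constantCoeff f = 0) : f = 0 := by
  have key : ∀ d : ℕ, ∀ m : Fin N →₀ ℕ, m.degree = d → MvPowerSeries.coeff m f = 0 := by
    intro d
    induction d using Nat.strong_induction_on with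
    | _ d ih =>
      intro m hm
      by_cases hm0 : m = 0
      · rw [hm0]; exact h0
      have h1 := coeff_todaOpB (q := q) (s := s) (f := f) (m := m)
        fun m' hm' => ih _ (hm ▸ hm') m' rfl
      rw [hf, map_smul, smul_eq_mul] at h1
      obtain ⟨i, hi⟩ := exists_xExponent_ne_zero hm0
      have h2 := hs (xExponent m) (fun e => hi (congrFun e i))
      by_contra h3
      exact h2 (mul_right_cancel₀ h3 h1).symm
  ext m
  exact key _ m rfl

theorem IsTodaFunctionB.unique {q : K} (hq : q ≠ 0) {s : Fin N → K} (hs : HasSimpleSpectrum q s)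
    {f g : LambdaB N K} (hf : IsTodaFunctionB q s f) (hg : IsTodaFunctionB q s g) : f = g := by
  rw [← sub_eq_zero]
  apply eq_zero_of_todaOpB_eq hs
  · rw [todaOpB_eq hq, map_sub, ← todaOpB_eq hq, ← todaOpB_eq hq, hf.1, hg.1, smul_sub]
  · rw [map_sub, hf.2, hg.2, sub_self]

/-! ### Genericity from algebraic independence -/

section Independence

variable {F : Type*} [Field F] [Algebra F K] {s : Fin N → K}

theorem eval_eq_zero_of_algebraicIndependent (hs : AlgebraicIndependent F s)
    {P : MvPolynomial (Fin N) F} (h : MvPolynomial.aeval s P = 0) (a : Fin N → F) :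
    MvPolynomial.eval a P = 0 := by
  rw [(algebraicIndependent_iff.mp hs) P h, map_zero]

theorem ne_zero_of_algebraicIndependent (hs : AlgebraicIndependent F s) (i : Fin N) :
    s i ≠ 0 := fun h => by
  have := eval_eq_zero_of_algebraicIndependent hs (P := MvPolynomial.X i) (by simpa using h) 1
  simp at this

/-- Each forbidden coincidence is a polynomial relation among the `s_i`. Evaluating it at a unit
vector, or at 0 for products, leaves a power of `p`, which is not 0. -/
theorem isGenericB_of_algebraicIndependent (hs : AlgebraicIndependent F s) {p : F} (hp : p ≠ 0)
    (hp' : ∀ n : ℕ, 0 < n → algebraMap F K p ^ n ≠ 1) : IsGenericB (algebraMap F K p) s where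
  q_ne_zero := by simpa using hp
  q_pow_ne := hp'
  ne_zero := ne_zero_of_algebraicIndependent hs
  ratio i j hij m k h := by
    have := eval_eq_zero_of_algebraicIndependent hs
      (P := MvPolynomial.C (p ^ m) * MvPolynomial.X i - MvPolynomial.C (p ^ k) * MvPolynomial.X j)
      (by simp [h]) (Pi.single i 1)
    simp [hij.symm, hp] at this
  mul_ne i j k h := by
    have := eval_eq_zero_of_algebraicIndependent hs
      (P := MvPolynomial.X i * MvPolynomial.X j - MvPolynomial.C (p ^ k)) (by simp [h]) 0
    simp [hp] at this

theorem hasSimpleSpectrum_of_algebraicIndependent (hs : AlgebraicIndependent F s) {p : F}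
    (hp' : ∀ n : ℕ, 0 < n → algebraMap F K p ^ n ≠ 1) :
    HasSimpleSpectrum (algebraMap F K p) s := by
  intro e he h
  obtain ⟨i₀, hi₀⟩ := Function.ne_iff.mp he
  have hs0 := ne_zero_of_algebraicIndependent hs
  have key := eval_eq_zero_of_algebraicIndependent hs
    -- This is the difference of eigenvalues multiplied by `∏ s_j` to clear denominators. At the
    -- point that is 0 in position `i₀` and 1 elsewhere, only `p^{-e_{i₀}} - 1` survives.
    (P := ∑ i, (MvPolynomial.C (p ^ e i - 1) * MvPolynomial.X i * ∏ j, MvPolynomial.X j +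
      MvPolynomial.C ((p ^ e i)⁻¹ - 1) * ∏ j with j ≠ i, MvPolynomial.X j)) ?_
    (fun j => if j = i₀ then 0 else 1)
  · have h1 : ∏ j : Fin N, (if j = i₀ then (0 : F) else 1) = 0 :=
      Finset.prod_eq_zero (Finset.mem_univ i₀) (if_pos rfl)
    have h2 : ∀ i, ∏ j with j ≠ i, (if j = i₀ then (0 : F) else 1) = if i = i₀ then 1 else 0 := by
      intro i
      split_ifs with hi
      · exact Finset.prod_eq_one fun j hj => if_neg (hi ▸ (Finset.mem_filter.mp hj).2)
      · exact Finset.prod_eq_zero (i := i₀) (by simpa using Ne.symm hi) (if_pos rfl)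
    simp only [map_sum, map_add, map_mul, map_prod, MvPolynomial.eval_C, MvPolynomial.eval_X, h1,
      h2, mul_zero, zero_add, mul_ite, mul_one, Finset.sum_ite_eq', Finset.mem_univ, if_true,
      sub_eq_zero, inv_eq_one] at key
    apply zpow_ne_one hp' hi₀
    rw [← map_zpow₀, key, map_one]
  · simp only [map_sum, map_add, map_mul, map_prod, MvPolynomial.aeval_C, MvPolynomial.aeval_X,
      map_sub, map_one, map_inv₀, map_zpow₀]
    have h3 : ∀ i, ∏ j with j ≠ i, s j = (s i)⁻¹ * ∏ j, s j := fun i => by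
      rw [← prod_ne_mul i s, inv_mul_cancel_left₀ (hs0 i)]
    have h4 := sub_eq_zero.mpr h
    rw [← Finset.sum_sub_distrib] at h4
    rw [← zero_mul (∏ j, s j), ← h4, Finset.sum_mul]
    refine Finset.sum_congr rfl fun i _ => ?_
    rw [h3]
    ring

end Independence

end

end QToda

theorem theorem2p6 {K : Type*} [Field K] [CharZero K] (N : ℕ) (hN : 1 ≤ N)
    (q : K) (hq0 : q ≠ 0) (hq : ∀ n : ℕ, 0 < n → q ^ n ≠ 1)
    (s : Fin N → K) (hs : AlgebraicIndependent (IntermediateField.adjoin ℚ {q}) s) :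
    (∃! f : QToda.LambdaB N K, QToda.IsTodaFunctionB q s f) ∧
    ∀ f : QToda.LambdaB N K, QToda.IsTodaFunctionB q s f →
      QToda.HasFormalSum (fun θ : Fin N → ℕ => QToda.branchingTerm q s θ) f := by
  -- Viewing `q` in the base field `ℚ(q)` makes its powers admissible as coefficients of the
  -- polynomial relations.
  let p : IntermediateField.adjoin ℚ {q} := ⟨q, IntermediateField.mem_adjoin_simple_self ℚ q⟩
  have hp : p ≠ 0 := fun h => hq0 (congrArg Subtype.val h)
  have hgen : QToda.IsGenericB q s := QToda.isGenericB_of_algebraicIndependent hs hp hq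
  have hspec : QToda.HasSimpleSpectrum q s :=
    QToda.hasSimpleSpectrum_of_algebraicIndependent hs (p := p) hq
  obtain ⟨f, hT, hf⟩ := QToda.exists_isTodaFunctionB hgen
  refine ⟨⟨f, hT, fun g hg => hg.unique hq0 hspec hT⟩, fun g hg => ?_⟩
  rw [hg.unique hq0 hspec hT]
  exact hf
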